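/- Let $K$ be a complete discretely valued field with ring of integers $K^\circ$ and uniformizer $\pi$, and let $K\{\mathbf X\}=K\{X_1,\dots,X_n\}$ be the Tate algebra of log-radii $\mathbf r=0$, i.e. the ring of power series whose coefficients tend to $0$. Fix a monomial order $\le_m$; order terms by $a\mathbf X^{\mathbf i}<b\mathbf X^{\mathbf j}$ if $\operatorname{val}(a)>\operatorname{val}(b)$, or $\operatorname{val}(a)=\operatorname{val}(b)$ and $\mathbf X^{\mathbf i}<_m\mathbf X^{\mathbf j}$; the leading term $\mathrm{LT}(f)$ of $f \neq 0$ is its maximal term. Let $I\subset K\{\mathbf X\}$ be an ideal with $\dim_K K\{\mathbf X\}/I<\infty$, and let $G=(g_1,\dots,g_s)$ be a Gröbner basis of $I$ (a family in $I$ such that $\mathrm{LT}(f)$ is divisible by some $\mathrm{LT}(g_a)$ for every nonzero $f\in I$) that is reduced (no non-leading term of a $g_a$ is divisible by any $\mathrm{LT}(g_b)$) and monic (all leading coefficients are $1$). Let $B$ be the set of monomials divisible by no $\mathrm{LT}(g_a)$, put $\bar B=\{X_im : 1\le i\le n,\ m\in B\}$, $\delta=|B|$ and $\epsilon=|\bar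 B\setminus B|$. For $P$ with support in $B$ write $[P]$ for its coordinate vector. Let $\mathrm{prec}\ge 0$ be an integer, and suppose that the leading monomials of the $g_a$ are given and that the coefficients of the $g_a$ are given modulo $\pi^{\mathrm{prec}}$ (by arbitrary representatives in $K^\circ$). The algorithm MulMat_iter starts with $\delta\times\delta$ zero matrices $T_1,\dots,T_n$ over $K^\circ$ (rows and columns indexed by $B$) and makes $\mathrm{prec}+1$ passes (for $k=0,\dots,\mathrm{prec}$) through the pairs $(i,m)$, $1\le i\le n$, $m\in B$, in increasing order of $X_im$. For each pair it performs the following assignment. - If $X_im\in B$: $T_i[m]\leftarrow[X_im]$. - Else, if $X_im=\mathrm{LT}(g)$ with $g\in G$: $T_i[m]\leftarrow[\mathrm{LT}(g)-g]$. - Else: write $m=X_jm'$ with $X_im'\notin B$, and set $T_i[m]\leftarrow T_j\cdot(T_i[m'])$. It may be run in two versions: every column is computed afresh for every pair, or (sharing version) when $X_im\notin B$ and a column for the same monomial $X_im=X_{i'}m''$ has already been computed in the current pass, that column is copied. Matrix-vector products are computed by the schoolbook method; an operation in $K^\circ$ is an addition, a multiplication or a change of sign. **Theorem.** $B$ is finite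 and its image is a $K$-basis of $K\{\mathbf X\}/I$. Let $M_i$ be the matrix of multiplication by $X_i$ on $K\{\mathbf X\}/I$ in this basis. For both versions, whatever choices are made for the order of pairs with equal $X_im$ and for the factorizations $m=X_jm'$: 1. for every $k\le\mathrm{prec}$, after $k$ passes, $T_i\equiv M_i\pmod{\pi^k K^\circ}$ for all $i$; 2. the output satisfies $T_i\equiv M_i\pmod{\pi^{\mathrm{prec}}K^\circ}$ for all $i$; 3. there is an absolute constant $C$ (independent of $K$, $n$, the order, $I$, $G$, $\mathrm{prec}$) such that each pass of the sharing version uses at most $C\,\delta^2\epsilon$ operations in $K^\circ$, and each pass of the version without sharing uses at most $C\,n\,\delta^2\epsilon$. -/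

import Mathlib

open scoped NormedField Valued

universe u v

namespace TateFGLM

/-! ### Tate algebras (log-radii zero) and Groebner bases

The base field `K` is a complete discretely valued field: a complete nonarchimedean normed field
whose ring of integers `𝒪[K]` is a discrete valuation ring. A larger norm is a smaller
valuation. -/

section Tate

variable (n : ℕ) (K : Type u) [NontriviallyNormedField K] [IsUltrametricDist K]

/-- The Tate algebra `K{X_1, …, X_n}` with log-radii zero: power series whose coefficients
tend to zero. -/
noncomputable def TateAlgebra : Subalgebra K (MvPowerSeries (Fin n) K) :=
  { MvPowerSeries.IsRestricted.subring (R := K) (fun _ : Fin n => (1 : ℝ)) with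
    algebraMap_mem' := fun a => MvPowerSeries.isRestricted_C (fun _ : Fin n => (1 : ℝ)) a }

variable {n}

/-- The monomial `X^m` as an element of the Tate algebra. -/
noncomputable def tateMonomial (m : Fin n →₀ ℕ) : TateAlgebra n K :=
  ⟨MvPowerSeries.monomial m 1,
    MvPowerSeries.isRestricted_monomial (fun _ : Fin n => (1 : ℝ)) m 1⟩

variable {K}

/-- The coefficient of `X^m` in a Tate series. -/
noncomputable def tateCoeff (m : Fin n →₀ ℕ) (f : TateAlgebra n K) : K :=
  MvPowerSeries.coeff m (f : MvPowerSeries (Fin n) K)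

/-- The strict order on terms: `a X^i < b X^j` if `a` has larger valuation than `b`, or the
valuations agree and `X^i` is smaller than `X^j` for the monomial order. -/
def TermLT (mo : MonomialOrder.{0, v} (Fin n)) (a : K) (i : Fin n →₀ ℕ) (b : K)
    (j : Fin n →₀ ℕ) : Prop :=
  ‖a‖ < ‖b‖ ∨ (‖a‖ = ‖b‖ ∧ mo.toSyn i < mo.toSyn j)

/-- `X^m` is the monomial of the leading (that is, the maximal) term of `f`. -/
def IsLeadingMonomial (mo : MonomialOrder.{0, v} (Fin n)) (f : TateAlgebra n K)
    (m : Fin n →₀ ℕ) : Prop :=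
  tateCoeff m f ≠ 0 ∧
    ∀ i, i ≠ m → tateCoeff i f ≠ 0 → TermLT mo (tateCoeff i f) i (tateCoeff m f) m

/-- `G` is a Groebner basis of `I`: its members lie in `I`, and the leading term of every
(nonzero) element of `I` is divisible by the leading term of some member of `G`. -/
def IsGroebnerBasis {s : ℕ} (mo : MonomialOrder.{0, v} (Fin n)) (I : Ideal (TateAlgebra n K))
    (G : Fin s → TateAlgebra n K) : Prop :=
  (∀ a, G a ∈ I) ∧
    ∀ f ∈ I, ∀ m, IsLeadingMonomial mo f m →
      ∃ a l, IsLeadingMonomial mo (G a) l ∧ l ≤ m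

/-- No non-leading term of a member of `G` is divisible by a leading term of a member of `G`. -/
def IsReduced {s : ℕ} (mo : MonomialOrder.{0, v} (Fin n)) (G : Fin s → TateAlgebra n K) : Prop :=
  ∀ a m, tateCoeff m (G a) ≠ 0 → ¬ IsLeadingMonomial mo (G a) m →
    ∀ b l, IsLeadingMonomial mo (G b) l → ¬ l ≤ m

/-- `x` and `y` agree modulo `π ^ k`, that is, `x - y ∈ π ^ k K°`. -/
def CongrMod (π : 𝒪[K]) (k : ℕ) (x y : K) : Prop :=
  ∃ c : 𝒪[K], x - y = (π : K) ^ k * (c : K)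

end Tate

/-- The monomials that are divisible by none of the monomials `X^(lm a)`. -/
def staircase {n s : ℕ} (lm : Fin s → (Fin n →₀ ℕ)) : Set (Fin n →₀ ℕ) :=
  {m | ∀ a, ¬ lm a ≤ m}

/-! ### Computations that count ring operations -/

/-- A value together with the number of ring operations spent on computing it. -/
structure Counted (α : Type u) where
  val : α
  ops : ℕ

namespace Counted

instance : Monad Counted where
  pure a := ⟨a, 0⟩
  bind x f := ⟨(f x.val).val, x.ops + (f x.val).ops⟩

variable {R : Type u} [CommRing R]

/-- An addition, counted as one operation. -/
def add (x y : R) : Counted R := ⟨x + y, 1⟩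

/-- A multiplication, counted as one operation. -/
def mul (x y : R) : Counted R := ⟨x * y, 1⟩

/-- A change of sign, counted as one operation. -/
def neg (x : R) : Counted R := ⟨-x, 1⟩

/-- Compute all coordinates of a vector; the operations add up. -/
def vec {ι : Type} [Fintype ι] (f : ι → Counted R) : Counted (ι → R) :=
  ⟨fun i => (f i).val, ∑ i, (f i).ops⟩

/-- The scalar product of two vectors, by the schoolbook method. -/
noncomputable def dot {ι : Type} [Fintype ι] (a b : ι → R) : Counted R :=
  (Finset.univ : Finset ι).toList.foldlM
    (fun c i => do
      let p ← mul (a i) (b i)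
      add c p) 0

/-- The product of a matrix and a vector, by the schoolbook method. -/
noncomputable def mulVec {ι : Type} [Fintype ι] (M : Matrix ι ι R) (w : ι → R) :
    Counted (ι → R) :=
  vec fun i => dot (M i) w

end Counted

/-! ### The iterative algorithm -/

section Algorithm

variable {n : ℕ}

/-- The monomial `X_i m`, for a pair `p = (i, m)`. -/
noncomputable def next {B : Finset (Fin n →₀ ℕ)} (p : Fin n × B) : Fin n →₀ ℕ :=
  Finsupp.single p.1 1 + (p.2 : Fin n →₀ ℕ)

/-- The boundary of `B`: the monomials `X_i m` with `m ∈ B` that are not in `B`. -/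
noncomputable def boundary (B : Finset (Fin n →₀ ℕ)) : Finset (Fin n →₀ ℕ) :=
  (Finset.univ : Finset (Fin n × B)).image next \ B

/-- `q = (j, m')` is such that `m = X_j m'` and `X_i m' ∉ B`, where `p = (i, m)`. -/
def IsFactorization {B : Finset (Fin n →₀ ℕ)} (p q : Fin n × B) : Prop :=
  (p.2 : Fin n →₀ ℕ) = next q ∧ next (p.1, q.2) ∉ B

/-- The choices that the algorithm leaves open: an enumeration of the pairs `(i, m)` by
increasing `X_i m`, and, for each pair that has a factorization, the choice of one. -/
structure Schedule (mo : MonomialOrder.{0, v} (Fin n)) (B : Finset (Fin n →₀ ℕ)) where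
  pairs : List (Fin n × B)
  nodup : pairs.Nodup
  complete : ∀ p, p ∈ pairs
  increasing : pairs.Pairwise fun p q => mo.toSyn (next p) ≤ mo.toSyn (next q)
  pick : Fin n × B → Fin n × B
  pick_spec : ∀ p, (∃ q, IsFactorization p q) → IsFactorization p (pick p)

/-- There is always at least one way to make these choices. -/
theorem Schedule.nonempty (mo : MonomialOrder.{0, v} (Fin n)) (B : Finset (Fin n →₀ ℕ)) :
    Nonempty (Schedule mo B) := by
  classical
  let r : Fin n × B → Fin n × B → Prop := fun p q => mo.toSyn (next p) ≤ mo.toSyn (next q)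
  have : Std.Total r := ⟨fun p q => le_total _ _⟩
  have : IsTrans _ r := ⟨fun p q t h1 h2 => le_trans h1 h2⟩
  have hp := List.perm_insertionSort r (Finset.univ : Finset (Fin n × B)).toList
  exact ⟨{
    pairs := (Finset.univ : Finset (Fin n × B)).toList.insertionSort r
    nodup := hp.nodup_iff.2 (Finset.nodup_toList _)
    complete := fun p => hp.mem_iff.2 (by simp)
    increasing := List.pairwise_insertionSort r _
    pick := fun p => if h : ∃ q, IsFactorization p q then h.choose else p
    pick_spec := fun p h => by rw [dif_pos h]; exact h.choose_spec }⟩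

/-- A family `T_1, …, T_n` of matrices with rows and columns indexed by `B`. -/
abbrev MatFamily (B : Finset (Fin n →₀ ℕ)) (R : Type u) : Type u :=
  Fin n → Matrix B B R

variable {B : Finset (Fin n →₀ ℕ)} {R : Type u} [CommRing R]

/-- Replace the column of `T_i` at `m` by `w`, where `p = (i, m)`. -/
def setCol (T : MatFamily B R) (p : Fin n × B) (w : B → R) : MatFamily B R :=
  Function.update T p.1 ((T p.1).updateCol p.2 w)

/-- The column of `T_i` at `m`, where `p = (i, m)`. -/
def getCol (T : MatFamily B R) (p : Fin n × B) : B → R := fun μ => T p.1 μ p.2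

variable {s : ℕ} {mo : MonomialOrder.{0, v} (Fin n)}

open Classical in
/-- The new column of `T_i` at `m`, where `p = (i, m)` and `X_i m ∉ B`. If `X_i m` is the leading
monomial of a basis element `g`, it is the coordinate vector of `X_i m - g`. Otherwise it is
`T_j (T_i [m'])`, with `m = X_j m'` and `X_i m' ∉ B`. -/
noncomputable def newColumn (lm : Fin s → (Fin n →₀ ℕ)) (g : Fin s → MvPolynomial (Fin n) R)
    (pick : Fin n × B → Fin n × B) (T : MatFamily B R) (p : Fin n × B) : Counted (B → R) :=
  if h : ∃ a, lm a = next p then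
    Counted.vec fun μ : B => Counted.neg (MvPolynomial.coeff (μ : Fin n →₀ ℕ) (g h.choose))
  else
    let q := pick p
    Counted.mulVec (T q.1) (getCol T (p.1, q.2))

/-- The treatment of the pair `p = (i, m)`; `done` lists the pairs already treated in the current
pass. With `share = true`, a column that was already computed in this pass for the
same monomial `X_i m ∉ B` is copied instead of being computed again. -/
noncomputable def mulMatStep (share : Bool) (lm : Fin s → (Fin n →₀ ℕ))
    (g : Fin s → MvPolynomial (Fin n) R) (pick : Fin n × B → Fin n × B)
    (done : List (Fin n × B)) (T : MatFamily B R) (p : Fin n × B) : Counted (MatFamily B R) :=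
  if h : next p ∈ B then
    pure (setCol T p (Pi.single ⟨next p, h⟩ 1))
  else
    match (if share then done.find? (fun q => decide (next q = next p)) else none) with
    | some q => pure (setCol T p (getCol T q))
    | none => do
        let w ← newColumn lm g pick T p
        pure (setCol T p w)

/-- One pass of the main loop: all pairs `(i, m)` are treated in the scheduled order. -/
noncomputable def mulMatPass (share : Bool) (lm : Fin s → (Fin n →₀ ℕ))
    (g : Fin s → MvPolynomial (Fin n) R) (sched : Schedule mo B) (T : MatFamily B R) :
    Counted (MatFamily B R) := do
  let r ← sched.pairs.foldlM
    (fun (st : List (Fin n × B) × MatFamily B R) p => do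
      let T' ← mulMatStep share lm g sched.pick st.1 st.2 p
      pure (st.1 ++ [p], T')) ([], T)
  pure r.2

/-- The state after the first `k` passes of the main loop, starting from zero matrices. -/
noncomputable def mulMatRun (share : Bool) (lm : Fin s → (Fin n →₀ ℕ))
    (g : Fin s → MvPolynomial (Fin n) R) (sched : ℕ → Schedule mo B) :
    ℕ → Counted (MatFamily B R)
  | 0 => pure 0
  | k + 1 => do
      let T ← mulMatRun share lm g sched k
      mulMatPass share lm g (sched k) T

/-- The algorithm `MulMat_iter`: the main loop runs for `k` from `0` to `prec`. -/
noncomputable def mulMatIter (share : Bool) (lm : Fin s → (Fin n →₀ ℕ))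
    (g : Fin s → MvPolynomial (Fin n) R) (sched : ℕ → Schedule mo B) (prec : ℕ) :
    Counted (MatFamily B R) :=
  mulMatRun share lm g sched (prec + 1)

/-- The number of ring operations of the pass that follows the first `k` passes. -/
noncomputable def passCost (share : Bool) (lm : Fin s → (Fin n →₀ ℕ))
    (g : Fin s → MvPolynomial (Fin n) R) (sched : ℕ → Schedule mo B) (k : ℕ) : ℕ :=
  (mulMatPass share lm g (sched k) (mulMatRun share lm g sched k).val).ops

end Algorithm

end TateFGLM

/-! A nonzero element of `I` has its leading monomial outside the staircase, so an element of `I`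
supported in the staircase is zero. This makes the staircase monomials independent modulo `I`;
finite dimension then makes `B` finite. They span by division. Modulo `ϖ` an integral series has
only finitely many terms, so it can be divided by the monic `G` by well-founded induction on
monomials. Iterating on the error and summing the geometrically decreasing corrections in the
complete field gives a true division (`exists_division`).

For `m ∉ B`, the series `X^m` minus its normal form lies in `I`, and `m` is its only monomial
outside `B`; so `m` is its leading monomial, with coefficient 1. Hence the coordinates of `X^m` are
integral, and those of norm 1 sit at monomials smaller than `m` (`norm_repr_le_and_lt`).

Precision grows because of the identity `T w - M c = T (w - c) + (T - M) c`, where `c` is the exact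
coordinate vector of some `m ∉ B` and `w` its approximation (`IsNormalForm.colClose_mulVec`). The
first summand is as small as `w - c`. In the second, a coordinate of `c` divisible by `ϖ`
contributes one extra digit, while a unit coordinate at `ν` forces `ν < m`, so the column of `X_j ν`
was already refreshed in the current pass. Each pass therefore gains a digit, up to the precision of
the input.

For the cost, a computed column takes at most `2δ²` operations. Sharing computes at most one column
per boundary monomial; without sharing there are at most `n` pairs per boundary monomial. -/

namespace TateFGLM

/-! ### Coefficients, leading monomials and uniform coefficient bounds -/

section TateBasics

variable {n : ℕ} {K : Type u} [NontriviallyNormedField K] [IsUltrametricDist K]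

theorem tate_ext {f g : TateAlgebra n K} (h : ∀ m, tateCoeff m f = tateCoeff m g) : f = g :=
  Subtype.ext (MvPowerSeries.ext h)

/-- The coefficient of `X^m` as a linear form. -/
noncomputable def tateCoeffHom (m : Fin n →₀ ℕ) : TateAlgebra n K →ₗ[K] K :=
  (MvPowerSeries.coeff m).comp (TateAlgebra n K).val.toLinearMap

@[simp] theorem tateCoeff_zero (m : Fin n →₀ ℕ) : tateCoeff m (0 : TateAlgebra n K) = 0 :=
  map_zero (tateCoeffHom m)

@[simp] theorem tateCoeff_add (m : Fin n →₀ ℕ) (f g : TateAlgebra n K) :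
    tateCoeff m (f + g) = tateCoeff m f + tateCoeff m g := map_add (tateCoeffHom m) f g

@[simp] theorem tateCoeff_sub (m : Fin n →₀ ℕ) (f g : TateAlgebra n K) :
    tateCoeff m (f - g) = tateCoeff m f - tateCoeff m g := map_sub (tateCoeffHom m) f g

@[simp] theorem tateCoeff_smul (m : Fin n →₀ ℕ) (c : K) (f : TateAlgebra n K) :
    tateCoeff m (c • f) = c * tateCoeff m f := map_smul (tateCoeffHom m) c f

@[simp] theorem tateCoeff_sum {ι : Type*} (m : Fin n →₀ ℕ) (t : Finset ι)
    (f : ι → TateAlgebra n K) : tateCoeff m (∑ i ∈ t, f i) = ∑ i ∈ t, tateCoeff m (f i) :=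
  map_sum (tateCoeffHom m) f t

open Classical in
theorem tateCoeff_monomial (m i : Fin n →₀ ℕ) :
    tateCoeff m (tateMonomial K i) = if m = i then 1 else 0 :=
  MvPowerSeries.coeff_monomial m i 1

theorem tateCoeff_mul (m : Fin n →₀ ℕ) (f g : TateAlgebra n K) :
    tateCoeff m (f * g)
      = ∑ p ∈ Finset.HasAntidiagonal.antidiagonal m, tateCoeff p.1 f * tateCoeff p.2 g := by
  classical
  exact MvPowerSeries.coeff_mul m _ _

theorem tateMonomial_mul (i j : Fin n →₀ ℕ) :
    tateMonomial K i * tateMonomial K j = tateMonomial K (i + j) :=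
  Subtype.ext (by simp [tateMonomial, MvPowerSeries.monomial_mul_monomial])

theorem tendsto_norm_tateCoeff (f : TateAlgebra n K) :
    Filter.Tendsto (fun m => ‖tateCoeff m f‖) Filter.cofinite (nhds 0) := by
  have h : MvPowerSeries.IsRestricted (fun _ : Fin n => (1 : ℝ)) (f : MvPowerSeries (Fin n) K) :=
    f.2
  simp only [MvPowerSeries.IsRestricted, Finsupp.prod, one_pow, Finset.prod_const_one,
    mul_one] at h
  exact h

theorem finite_le_norm_tateCoeff (f : TateAlgebra n K) {ε : ℝ} (hε : 0 < ε) :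
    {m | ε ≤ ‖tateCoeff m f‖}.Finite := by
  have := (tendsto_norm_tateCoeff f).eventually (gt_mem_nhds hε)
  simpa [Filter.eventually_cofinite] using this

/-- The Tate series with given coefficients that tend to zero. -/
noncomputable def tateOfCoeff (c : (Fin n →₀ ℕ) → K)
    (hc : Filter.Tendsto (fun m => ‖c m‖) Filter.cofinite (nhds 0)) : TateAlgebra n K :=
  ⟨fun m => c m, by
    have : MvPowerSeries.IsRestricted (fun _ : Fin n => (1 : ℝ))
        (fun m => c m : MvPowerSeries (Fin n) K) := by
      simp only [MvPowerSeries.IsRestricted, Finsupp.prod, one_pow, Finset.prod_const_one, mul_one]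
      exact hc
    exact this⟩

theorem tateCoeff_tateOfCoeff (c : (Fin n →₀ ℕ) → K)
    (hc : Filter.Tendsto (fun m => ‖c m‖) Filter.cofinite (nhds 0)) (m : Fin n →₀ ℕ) :
    tateCoeff m (tateOfCoeff c hc) = c m := rfl

variable {mo : MonomialOrder.{0, v} (Fin n)}

theorem IsLeadingMonomial.norm_le {f : TateAlgebra n K} {m : Fin n →₀ ℕ}
    (h : IsLeadingMonomial mo f m) (i : Fin n →₀ ℕ) : ‖tateCoeff i f‖ ≤ ‖tateCoeff m f‖ := by
  by_cases hi : i = m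
  · rw [hi]
  by_cases h0 : tateCoeff i f = 0
  · simp [h0]
  rcases h.2 i hi h0 with h | h
  exacts [h.le, h.1.le]

theorem IsLeadingMonomial.lt {f : TateAlgebra n K} {m : Fin n →₀ ℕ}
    (h : IsLeadingMonomial mo f m) {i : Fin n →₀ ℕ} (hi : i ≠ m)
    (hn : ‖tateCoeff m f‖ ≤ ‖tateCoeff i f‖) : mo.toSyn i < mo.toSyn m := by
  have h0 : tateCoeff i f ≠ 0 := norm_pos_iff.1 ((norm_pos_iff.2 h.1).trans_le hn)
  rcases h.2 i hi h0 with h | h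
  exacts [absurd hn (not_le.2 h), h.2]

theorem IsLeadingMonomial.unique {f : TateAlgebra n K} {m l : Fin n →₀ ℕ}
    (h : IsLeadingMonomial mo f m) (h' : IsLeadingMonomial mo f l) : m = l := by
  by_contra hne
  exact lt_asymm (h.lt (Ne.symm hne) (h'.norm_le m)) (h'.lt hne (h.norm_le l))

/-- Coefficients tend to zero, so only finitely many are at least as large as a given nonzero one.
The norm is maximized first, then the monomial among the coefficients of maximal norm. -/
theorem exists_isLeadingMonomial (mo : MonomialOrder.{0, v} (Fin n)) {f : TateAlgebra n K}
    (hf : f ≠ 0) : ∃ m, IsLeadingMonomial mo f m := by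
  obtain ⟨m₀, h₀⟩ : ∃ m, tateCoeff m f ≠ 0 := by
    by_contra! h
    exact hf (tate_ext fun m => by rw [h m, tateCoeff_zero])
  have hfin := finite_le_norm_tateCoeff f (norm_pos_iff.2 h₀)
  obtain ⟨m₁, hm₁, hmax⟩ := hfin.exists_maximalFor (fun m => ‖tateCoeff m f‖) _ ⟨m₀, by simp⟩
  have hle : ∀ i, ‖tateCoeff i f‖ ≤ ‖tateCoeff m₁ f‖ := fun i => by
    by_cases hi : ‖tateCoeff m₀ f‖ ≤ ‖tateCoeff i f‖
    · exact le_of_not_gt fun hlt => absurd (hmax hi hlt.le) (not_le.2 hlt)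
    · exact (not_le.1 hi).le.trans hm₁
  have h₁ : 0 < ‖tateCoeff m₁ f‖ := (norm_pos_iff.2 h₀).trans_le hm₁
  obtain ⟨m, hm, hmax'⟩ :=
    (finite_le_norm_tateCoeff f h₁).exists_maximalFor (fun m => mo.toSyn m) _ ⟨m₁, by simp⟩
  refine ⟨m, norm_pos_iff.1 (h₁.trans_le hm), fun i hi _ => ?_⟩
  rcases lt_or_ge ‖tateCoeff i f‖ ‖tateCoeff m f‖ with h | h
  · exact Or.inl h
  refine Or.inr ⟨le_antisymm ((hle i).trans hm) h, lt_of_not_ge fun hge => hi ?_⟩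
  have hi' : ‖tateCoeff m₁ f‖ ≤ ‖tateCoeff i f‖ := le_trans hm h
  exact mo.toSyn.injective (le_antisymm (hmax' hi' hge) hge)

/-- All coefficients of `f` have norm at most `c`. -/
def CoeffBound (c : ℝ) (f : TateAlgebra n K) : Prop := ∀ m, ‖tateCoeff m f‖ ≤ c

theorem CoeffBound.add {c : ℝ} {f g : TateAlgebra n K} (hf : CoeffBound c f)
    (hg : CoeffBound c g) : CoeffBound c (f + g) := fun m => by
  rw [tateCoeff_add]
  exact (IsUltrametricDist.norm_add_le_max _ _).trans (max_le (hf m) (hg m))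

theorem CoeffBound.smul {c : ℝ} {f : TateAlgebra n K} (hf : CoeffBound c f) (a : K) :
    CoeffBound (‖a‖ * c) (a • f) := fun m => by
  rw [tateCoeff_smul, norm_mul]
  exact mul_le_mul_of_nonneg_left (hf m) (norm_nonneg _)

theorem CoeffBound.smul_of_norm_le_one {c : ℝ} {f : TateAlgebra n K} (hf : CoeffBound c f) {a : K}
    (ha : ‖a‖ ≤ 1) : CoeffBound c (a • f) := fun m => by
  rw [tateCoeff_smul, norm_mul]
  exact (mul_le_of_le_one_left (norm_nonneg _) ha).trans (hf m)

theorem CoeffBound.sub {c : ℝ} {f g : TateAlgebra n K} (hf : CoeffBound c f)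
    (hg : CoeffBound c g) : CoeffBound c (f - g) := by
  simpa [sub_eq_add_neg] using hf.add (hg.smul_of_norm_le_one (a := -1) (by simp))

theorem CoeffBound.zero {c : ℝ} (hc : 0 ≤ c) : CoeffBound c (0 : TateAlgebra n K) := fun m => by
  simpa using hc

theorem CoeffBound.sum {ι : Type*} {c : ℝ} (hc : 0 ≤ c) (t : Finset ι) {f : ι → TateAlgebra n K}
    (hf : ∀ i ∈ t, CoeffBound c (f i)) : CoeffBound c (∑ i ∈ t, f i) :=
  Finset.sum_induction f (CoeffBound c) (fun _ _ => CoeffBound.add) (CoeffBound.zero hc) hf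

theorem CoeffBound.mul {c d : ℝ} {f g : TateAlgebra n K} (hf : CoeffBound c f)
    (hg : CoeffBound d g) : CoeffBound (c * d) (f * g) := fun m => by
  have hc : 0 ≤ c := (norm_nonneg _).trans (hf 0)
  have hd : 0 ≤ d := (norm_nonneg _).trans (hg 0)
  rw [tateCoeff_mul]
  refine IsUltrametricDist.norm_sum_le_of_forall_le_of_nonneg (mul_nonneg hc hd) fun p _ => ?_
  rw [norm_mul]
  exact mul_le_mul (hf _) (hg _) (norm_nonneg _) hc

theorem coeffBound_tateMonomial (m : Fin n →₀ ℕ) : CoeffBound 1 (tateMonomial K m) := fun i => by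
  rw [tateCoeff_monomial]
  split_ifs <;> simp

theorem eq_zero_of_forall_coeffBound_pow {ρ : ℝ} (h0 : 0 ≤ ρ) (h1 : ρ < 1) {f : TateAlgebra n K}
    (hf : ∀ N : ℕ, CoeffBound (ρ ^ N) f) : f = 0 := by
  refine tate_ext fun m => ?_
  rw [tateCoeff_zero, ← norm_le_zero_iff]
  exact ge_of_tendsto' (tendsto_pow_atTop_nhds_zero_of_lt_one h0 h1) fun N => hf N m

/-- Completeness of the unit ball of the Tate algebra. -/
theorem exists_tate_limit [CompleteSpace K] {ϖ : K} (h1 : ‖ϖ‖ < 1)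
    (w : ℕ → TateAlgebra n K) (hw : ∀ k, CoeffBound 1 (w k)) :
    ∃ U : TateAlgebra n K,
      ∀ N : ℕ, CoeffBound (‖ϖ‖ ^ N) (U - ∑ j ∈ Finset.range N, ϖ ^ j • w j) := by
  have hb : ∀ m j, ‖ϖ ^ j * tateCoeff m (w j)‖ ≤ ‖ϖ‖ ^ j := fun m j => by
    rw [norm_mul, norm_pow]
    exact mul_le_of_le_one_right (by positivity) (hw j m)
  have hs : ∀ m, Summable fun j => ϖ ^ j * tateCoeff m (w j) := fun m =>
    Summable.of_norm_bounded (summable_geometric_of_lt_one (norm_nonneg _) h1) (hb m)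
  let c : (Fin n →₀ ℕ) → K := fun m => ∑' j, ϖ ^ j * tateCoeff m (w j)
  have hc : ∀ (N : ℕ) m,
      ‖c m - tateCoeff m (∑ j ∈ Finset.range N, ϖ ^ j • w j)‖ ≤ ‖ϖ‖ ^ N := fun N m => by
    have : c m - tateCoeff m (∑ j ∈ Finset.range N, ϖ ^ j • w j)
        = ∑' j, ϖ ^ (j + N) * tateCoeff m (w (j + N)) := by
      simp only [tateCoeff_sum, tateCoeff_smul, c]
      rw [← (hs m).sum_add_tsum_nat_add N, add_sub_cancel_left]
    rw [this]
    refine IsUltrametricDist.norm_tsum_le_of_forall_le_of_nonneg (by positivity) fun j => ?_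
    exact (hb m (j + N)).trans (pow_le_pow_of_le_one (norm_nonneg _) h1.le (by omega))
  -- A partial sum is itself a Tate series, and the tail is bounded by `‖ϖ‖ ^ N` uniformly in the
  -- monomial.
  have ht : Filter.Tendsto (fun m => ‖c m‖) Filter.cofinite (nhds 0) := by
    refine Metric.tendsto_nhds.2 fun ε hε => ?_
    obtain ⟨N, hN⟩ := exists_pow_lt_of_lt_one hε h1
    filter_upwards [(tendsto_norm_tateCoeff (∑ j ∈ Finset.range N, ϖ ^ j • w j)).eventually
      (gt_mem_nhds hε)] with m hm
    rw [dist_zero_right, norm_norm, ← sub_add_cancel (c m)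
      (tateCoeff m (∑ j ∈ Finset.range N, ϖ ^ j • w j))]
    exact (IsUltrametricDist.norm_add_le_max _ _).trans_lt (max_lt ((hc N m).trans_lt hN) hm)
  refine ⟨tateOfCoeff c ht, fun N m => ?_⟩
  rw [tateCoeff_sub, tateCoeff_tateOfCoeff]
  exact hc N m

/-- A series with integral coefficients is the sum of its terms of norm one and a multiple of the
uniformizer. -/
theorem exists_eq_sum_add_smul {ϖ : K} (h0 : ϖ ≠ 0)
    (hϖ : ∀ x : K, ‖x‖ < 1 → ‖x‖ ≤ ‖ϖ‖) (f : TateAlgebra n K) :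
    ∃ (t : Finset (Fin n →₀ ℕ)) (f' : TateAlgebra n K), (∀ i ∈ t, 1 ≤ ‖tateCoeff i f‖) ∧
      CoeffBound 1 f' ∧ f = ∑ i ∈ t, tateCoeff i f • tateMonomial K i + ϖ • f' := by
  classical
  -- By `hϖ`, a coefficient of norm below 1 has norm at most `‖ϖ‖`; what remains after removing this
  -- finite set of terms is divisible by `ϖ`.
  have hfin := finite_le_norm_tateCoeff f one_pos
  refine ⟨hfin.toFinset, ϖ⁻¹ • (f - ∑ i ∈ hfin.toFinset, tateCoeff i f • tateMonomial K i),
    fun i hi => by simpa using hi, fun m => ?_, by rw [smul_inv_smul₀ h0]; abel⟩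
  rw [tateCoeff_smul, norm_mul, norm_inv, inv_mul_le_one₀ (norm_pos_iff.2 h0)]
  simp only [tateCoeff_sub, tateCoeff_sum, tateCoeff_smul, tateCoeff_monomial, mul_ite, mul_one,
    mul_zero, Finset.sum_ite_eq, Set.Finite.mem_toFinset, Set.mem_ofPred_eq]
  split_ifs with h
  · simp
  · simpa using hϖ _ (not_le.1 h)

end TateBasics

/-! ### Division by the Gröbner basis and the staircase basis -/

section Division

variable {n s : ℕ} {K : Type u} [NontriviallyNormedField K] [IsUltrametricDist K]
  {mo : MonomialOrder.{0, v} (Fin n)} {I : Ideal (TateAlgebra n K)}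
  {G : Fin s → TateAlgebra n K} {lm : Fin s → (Fin n →₀ ℕ)}

theorem coeffBound_one_of_monic {f : TateAlgebra n K} {m : Fin n →₀ ℕ}
    (h : IsLeadingMonomial mo f m) (h1 : tateCoeff m f = 1) : CoeffBound 1 f := fun i => by
  simpa [h1] using h.norm_le i

theorem IsGroebnerBasis.not_mem_staircase (hG : IsGroebnerBasis mo I G)
    (hlm : ∀ a, IsLeadingMonomial mo (G a) (lm a)) {f : TateAlgebra n K} (hf : f ∈ I)
    {m : Fin n →₀ ℕ} (hm : IsLeadingMonomial mo f m) : m ∉ staircase lm := fun h => by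
  obtain ⟨a, l, hl, hle⟩ := hG.2 f hf m hm
  exact h a (hl.unique (hlm a) ▸ hle)

/-- An element of the ideal supported in the staircase vanishes. -/
theorem IsGroebnerBasis.eq_zero (hG : IsGroebnerBasis mo I G)
    (hlm : ∀ a, IsLeadingMonomial mo (G a) (lm a)) {f : TateAlgebra n K} (hf : f ∈ I)
    (hs : ∀ m ∉ staircase lm, tateCoeff m f = 0) : f = 0 := by
  by_contra h0
  obtain ⟨m, hm⟩ := exists_isLeadingMonomial mo h0
  exact hm.1 (hs m (hG.not_mem_staircase hlm hf hm))

theorem IsReduced.tateCoeff_eq_zero (hred : IsReduced mo G)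
    (hlm : ∀ a, IsLeadingMonomial mo (G a) (lm a)) (a : Fin s) {m : Fin n →₀ ℕ}
    (hm : m ∉ staircase lm) (hne : m ≠ lm a) : tateCoeff m (G a) = 0 := by
  by_contra h0
  simp only [staircase, Set.mem_ofPred_eq, not_forall, not_not] at hm
  obtain ⟨b, hb⟩ := hm
  exact hred a m h0 (fun h => hne (h.unique (hlm a))) b (lm b) (hlm b) hb

/-- A linear relation lifts to an element of `I` supported in the staircase, which vanishes. -/
theorem linearIndependent_staircase (hG : IsGroebnerBasis mo I G)
    (hlm : ∀ a, IsLeadingMonomial mo (G a) (lm a)) :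
    LinearIndependent K fun m : staircase lm =>
      Ideal.Quotient.mk I (tateMonomial K (m : Fin n →₀ ℕ)) := by
  classical
  rw [linearIndependent_iff']
  intro t c hc m hm
  have hI : ∑ i ∈ t, c i • tateMonomial K (i : Fin n →₀ ℕ) ∈ I := by
    rw [← Ideal.Quotient.eq_zero_iff_mem, map_sum, ← hc]
    rfl
  have h0 := hG.eq_zero hlm hI fun l hl => by
    rw [tateCoeff_sum]
    refine Finset.sum_eq_zero fun i _ => ?_
    rw [tateCoeff_smul, tateCoeff_monomial, if_neg (fun h : l = i => hl (h ▸ i.2)), mul_zero]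
  have := congrArg (tateCoeff (m : Fin n →₀ ℕ)) h0
  simpa [tateCoeff_monomial, Subtype.coe_inj, hm] using this

/-- `f` can be divided by `G` with integral quotients and remainder, up to a multiple
of `ϖ`. -/
def DivisibleModulo (lm : Fin s → (Fin n →₀ ℕ)) (G : Fin s → TateAlgebra n K) (ϖ : K)
    (f : TateAlgebra n K) : Prop :=
  ∃ (q : Fin s → TateAlgebra n K) (r f' : TateAlgebra n K), (∀ a, CoeffBound 1 (q a)) ∧
    CoeffBound 1 r ∧ (∀ m ∉ staircase lm, tateCoeff m r = 0) ∧ CoeffBound 1 f' ∧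
    f = ∑ a, q a * G a + r + ϖ • f'

variable {ϖ : K}

theorem DivisibleModulo.add {f g : TateAlgebra n K} (hf : DivisibleModulo lm G ϖ f)
    (hg : DivisibleModulo lm G ϖ g) : DivisibleModulo lm G ϖ (f + g) := by
  obtain ⟨q, r, f', hq, hr, hs, hf', rfl⟩ := hf
  obtain ⟨q₁, r₁, f₁, hq₁, hr₁, hs₁, hf₁, rfl⟩ := hg
  refine ⟨q + q₁, r + r₁, f' + f₁, fun a => (hq a).add (hq₁ a), hr.add hr₁,
    fun m hm => by rw [tateCoeff_add, hs m hm, hs₁ m hm, add_zero], hf'.add hf₁, ?_⟩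
  simp only [Pi.add_apply, add_mul, Finset.sum_add_distrib, smul_add]
  abel

theorem DivisibleModulo.smul {f : TateAlgebra n K} (hf : DivisibleModulo lm G ϖ f) {c : K}
    (hc : ‖c‖ ≤ 1) : DivisibleModulo lm G ϖ (c • f) := by
  obtain ⟨q, r, f', hq, hr, hs, hf', rfl⟩ := hf
  refine ⟨fun a => c • q a, c • r, c • f', fun a => (hq a).smul_of_norm_le_one hc,
    hr.smul_of_norm_le_one hc, fun m hm => by rw [tateCoeff_smul, hs m hm, mul_zero],
    hf'.smul_of_norm_le_one hc, ?_⟩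
  simp only [smul_add, Finset.smul_sum, smul_mul_assoc, smul_comm c ϖ]

theorem DivisibleModulo.of_smul {f : TateAlgebra n K} (hf : CoeffBound 1 f) :
    DivisibleModulo lm G ϖ (ϖ • f) :=
  ⟨0, 0, f, fun _ => CoeffBound.zero zero_le_one, CoeffBound.zero zero_le_one, by simp, hf,
    by simp⟩

theorem DivisibleModulo.of_mul {q : TateAlgebra n K} (hq : CoeffBound 1 q) (a : Fin s) :
    DivisibleModulo lm G ϖ (q * G a) := by
  classical
  refine ⟨Pi.single a q, 0, 0, fun b => ?_, CoeffBound.zero zero_le_one, by simp,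
    CoeffBound.zero zero_le_one, ?_⟩
  · by_cases h : b = a
    · subst h; simpa using hq
    · simpa [h] using CoeffBound.zero zero_le_one
  · rw [Finset.sum_eq_single a (fun b _ h => by simp [h]) (by simp)]
    simp

theorem DivisibleModulo.sum {ι : Type*} (t : Finset ι) {f : ι → TateAlgebra n K}
    (hf : ∀ i ∈ t, DivisibleModulo lm G ϖ (f i)) : DivisibleModulo lm G ϖ (∑ i ∈ t, f i) :=
  Finset.sum_induction f _ (fun _ _ => DivisibleModulo.add)
    ⟨0, 0, 0, fun _ => CoeffBound.zero zero_le_one, CoeffBound.zero zero_le_one, by simp,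
      CoeffBound.zero zero_le_one, by simp⟩ hf

/-- Outside the staircase, `X^(lm a + l)` is rewritten as `X^l * G a` plus `X^l (X^(lm a) - G a)`.
Modulo `ϖ` the latter is a finite combination of strictly smaller monomials, to which induction
applies. -/
theorem divisibleModulo_tateMonomial (h0 : ϖ ≠ 0) (hϖ : ∀ x : K, ‖x‖ < 1 → ‖x‖ ≤ ‖ϖ‖)
    (hlm : ∀ a, IsLeadingMonomial mo (G a) (lm a)) (hmon : ∀ a, tateCoeff (lm a) (G a) = 1)
    (m : Fin n →₀ ℕ) : DivisibleModulo lm G ϖ (tateMonomial K m) := by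
  classical
  induction hx : mo.toSyn m using WellFoundedLT.induction generalizing m with
  | ind x ih =>
    subst hx
    by_cases hm : m ∈ staircase lm
    · refine ⟨0, tateMonomial K m, 0, fun _ => CoeffBound.zero zero_le_one,
        coeffBound_tateMonomial m, fun i hi => ?_, CoeffBound.zero zero_le_one, by simp⟩
      rw [tateCoeff_monomial, if_neg (fun h : i = m => hi (h ▸ hm))]
    obtain ⟨a, ha⟩ : ∃ a, lm a ≤ m := by simpa [staircase] using hm
    obtain ⟨l, rfl⟩ := exists_add_of_le ha
    have hGa := coeffBound_one_of_monic (hlm a) (hmon a)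
    have hh : CoeffBound 1 (tateMonomial K (lm a) - G a) := (coeffBound_tateMonomial _).sub hGa
    obtain ⟨t, h', ht, hb, heq⟩ :=
      exists_eq_sum_add_smul h0 hϖ (tateMonomial K (lm a) - G a)
    have key : tateMonomial K (lm a + l) = tateMonomial K l * G a
        + (∑ i ∈ t, tateCoeff i (tateMonomial K (lm a) - G a) • tateMonomial K (l + i)
          + ϖ • (tateMonomial K l * h')) := by
      calc tateMonomial K (lm a + l)
          = tateMonomial K l * G a + tateMonomial K l * (tateMonomial K (lm a) - G a) := by
            rw [← tateMonomial_mul]; ring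
        _ = _ := by
            conv_lhs => rw [heq]
            simp only [mul_add, Finset.mul_sum, mul_smul_comm, tateMonomial_mul]
    rw [key]
    refine (DivisibleModulo.of_mul (coeffBound_tateMonomial l) a).add
      ((DivisibleModulo.sum t fun i hi => ?_).add
        (DivisibleModulo.of_smul (by simpa using (coeffBound_tateMonomial l).mul hb)))
    -- The terms kept in `t` have norm at least 1, the norm of the leading coefficient, so the
    -- leading term beats them only through the monomial order.
    refine (ih _ ?_ (l + i) rfl).smul (hh i)
    have hne : i ≠ lm a := by
      rintro rfl
      have := ht _ hi
      rw [tateCoeff_sub, tateCoeff_monomial, hmon] at this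
      norm_num at this
    have hlt := (hlm a).lt hne (by
      have := ht _ hi
      rw [tateCoeff_sub, tateCoeff_monomial, if_neg hne, zero_sub, norm_neg] at this
      simpa [hmon] using this)
    rw [map_add, map_add, add_comm]
    exact add_lt_add_left hlt _

theorem divisibleModulo_of_coeffBound (h0 : ϖ ≠ 0) (hϖ : ∀ x : K, ‖x‖ < 1 → ‖x‖ ≤ ‖ϖ‖)
    (hlm : ∀ a, IsLeadingMonomial mo (G a) (lm a)) (hmon : ∀ a, tateCoeff (lm a) (G a) = 1)
    {f : TateAlgebra n K} (hf : CoeffBound 1 f) : DivisibleModulo lm G ϖ f := by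
  obtain ⟨t, h', -, hb, heq⟩ := exists_eq_sum_add_smul h0 hϖ f
  rw [heq]
  exact (DivisibleModulo.sum t fun i _ =>
    (divisibleModulo_tateMonomial h0 hϖ hlm hmon i).smul (hf i)).add (DivisibleModulo.of_smul hb)

/-- Division with remainder of a series with integral coefficients. -/
theorem exists_division_of_coeffBound [CompleteSpace K] (h0 : ϖ ≠ 0) (h1 : ‖ϖ‖ < 1)
    (hϖ : ∀ x : K, ‖x‖ < 1 → ‖x‖ ≤ ‖ϖ‖)
    (hlm : ∀ a, IsLeadingMonomial mo (G a) (lm a)) (hmon : ∀ a, tateCoeff (lm a) (G a) = 1)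
    {f : TateAlgebra n K} (hf : CoeffBound 1 f) :
    ∃ (q : Fin s → TateAlgebra n K) (r : TateAlgebra n K),
      (∀ m ∉ staircase lm, tateCoeff m r = 0) ∧ f = ∑ a, q a * G a + r := by
  choose q r f' hq hr hs hf' heq using
    fun f : {f : TateAlgebra n K // CoeffBound 1 f} =>
      divisibleModulo_of_coeffBound (ϖ := ϖ) h0 hϖ hlm hmon f.2
  -- `F k` is the error left after `k` divisions modulo `ϖ`; it enters `f` with the factor `ϖ ^ k`.
  let F : ℕ → {f : TateAlgebra n K // CoeffBound 1 f} :=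
    fun k => (fun x => ⟨f' x, hf' x⟩)^[k] ⟨f, hf⟩
  have hF : ∀ k, (F (k + 1)).1 = f' (F k) := fun k => by
    simp only [F, Function.iterate_succ_apply']
  have hsum : ∀ N : ℕ, f = ∑ a, (∑ j ∈ Finset.range N, ϖ ^ j • q (F j) a) * G a
      + ∑ j ∈ Finset.range N, ϖ ^ j • r (F j) + ϖ ^ N • (F N).1 := fun N => by
    induction N with
    | zero => simp [F]
    | succ N ih =>
      conv_lhs => rw [ih, heq (F N)]
      simp only [Finset.sum_range_succ, hF, add_mul, Finset.sum_add_distrib, smul_add,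
        Finset.smul_sum, smul_mul_assoc, pow_succ, mul_smul]
      abel
  choose Q hQ using fun a => exists_tate_limit h1 (fun k => q (F k) a) fun k => hq (F k) a
  obtain ⟨R, hR⟩ := exists_tate_limit h1 (fun k => r (F k)) fun k => hr (F k)
  refine ⟨Q, R, fun m hm => ?_, ?_⟩
  · rw [← norm_le_zero_iff]
    refine ge_of_tendsto' (tendsto_pow_atTop_nhds_zero_of_lt_one (norm_nonneg ϖ) h1) fun N => ?_
    have := hR N m
    rwa [tateCoeff_sub, tateCoeff_sum, Finset.sum_eq_zero (fun j _ => by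
      rw [tateCoeff_smul, hs _ m hm, mul_zero]), sub_zero] at this
  · rw [← sub_eq_zero]
    refine eq_zero_of_forall_coeffBound_pow (norm_nonneg ϖ) h1 fun N => ?_
    have hρ : (0 : ℝ) ≤ ‖ϖ‖ ^ N := by positivity
    have hF1 : CoeffBound (‖ϖ‖ ^ N) (ϖ ^ N • (F N).1) := by
      simpa using (F N).2.smul (ϖ ^ N)
    have hQ1 : CoeffBound (‖ϖ‖ ^ N)
        (∑ a, (Q a - ∑ j ∈ Finset.range N, ϖ ^ j • q (F j) a) * G a) :=
      CoeffBound.sum hρ _ fun a _ => by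
        simpa using (hQ a N).mul (coeffBound_one_of_monic (hlm a) (hmon a))
    -- By `hsum N`, the defect of the limit division is the `N`-th error minus the two truncation
    -- errors, all bounded by `‖ϖ‖ ^ N`.
    have := (hF1.sub hQ1).sub (hR N)
    convert this using 1
    conv_lhs => rw [hsum N]
    simp only [sub_mul, Finset.sum_sub_distrib]
    abel

/-- Division with remainder. -/
theorem exists_division [CompleteSpace K] (h0 : ϖ ≠ 0) (h1 : ‖ϖ‖ < 1)
    (hϖ : ∀ x : K, ‖x‖ < 1 → ‖x‖ ≤ ‖ϖ‖) (hG : IsGroebnerBasis mo I G)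
    (hlm : ∀ a, IsLeadingMonomial mo (G a) (lm a)) (hmon : ∀ a, tateCoeff (lm a) (G a) = 1)
    (f : TateAlgebra n K) :
    ∃ r : TateAlgebra n K, (∀ m ∉ staircase lm, tateCoeff m r = 0) ∧ f - r ∈ I := by
  by_cases hf : f = 0
  · exact ⟨0, by simp, by simp [hf]⟩
  obtain ⟨m, hm⟩ := exists_isLeadingMonomial mo hf
  -- Dividing by the leading coefficient, which has maximal norm, makes `f` integral.
  obtain ⟨q, r, hs, heq⟩ := exists_division_of_coeffBound (f := (tateCoeff m f)⁻¹ • f) h0 h1 hϖ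
    hlm hmon fun i => by
      rw [tateCoeff_smul, norm_mul, norm_inv, inv_mul_le_one₀ (norm_pos_iff.2 hm.1)]
      exact hm.norm_le i
  refine ⟨tateCoeff m f • r, fun i hi => by rw [tateCoeff_smul, hs i hi, mul_zero], ?_⟩
  rw [inv_smul_eq_iff₀ hm.1] at heq
  have : f - tateCoeff m f • r = algebraMap K _ (tateCoeff m f) * ∑ a, q a * G a := by
    have h := heq
    rw [smul_add, ← sub_eq_iff_eq_add] at h
    rw [h, Algebra.smul_def]
  rw [this]
  exact I.mul_mem_left _ (I.sum_mem fun a _ => I.mul_mem_left _ (hG.1 a))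

variable {B : Finset (Fin n →₀ ℕ)}

theorem exists_basis [CompleteSpace K] (h0 : ϖ ≠ 0) (h1 : ‖ϖ‖ < 1)
    (hϖ : ∀ x : K, ‖x‖ < 1 → ‖x‖ ≤ ‖ϖ‖) (hG : IsGroebnerBasis mo I G)
    (hlm : ∀ a, IsLeadingMonomial mo (G a) (lm a)) (hmon : ∀ a, tateCoeff (lm a) (G a) = 1)
    (hB : (B : Set (Fin n →₀ ℕ)) = staircase lm) :
    ∃ b : Module.Basis B K (TateAlgebra n K ⧸ I),
      ∀ m : B, b m = Ideal.Quotient.mk I (tateMonomial K (m : Fin n →₀ ℕ)) := by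
  classical
  have hmem : ∀ m, m ∈ B ↔ m ∈ staircase lm := fun m => by rw [← hB, Finset.mem_coe]
  have hli : LinearIndependent K fun m : B =>
      Ideal.Quotient.mk I (tateMonomial K (m : Fin n →₀ ℕ)) :=
    (linearIndependent_staircase (K := K) hG hlm).comp
      (fun m : B => (⟨m, (hmem m).1 m.2⟩ : staircase lm))
      fun m l h => Subtype.ext (congrArg (fun x : staircase lm => (x : Fin n →₀ ℕ)) h)
  refine ⟨Module.Basis.mk hli fun x _ => ?_, fun m => Module.Basis.mk_apply _ _ _⟩
  obtain ⟨f, rfl⟩ := Ideal.Quotient.mk_surjective x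
  obtain ⟨r, hs, hr⟩ := exists_division h0 h1 hϖ hG hlm hmon f
  have hsum : r = ∑ m : B, tateCoeff m r • tateMonomial K (m : Fin n →₀ ℕ) := by
    refine tate_ext fun l => ?_
    rw [Finset.sum_coe_sort B fun m => tateCoeff m r • tateMonomial K m]
    simp only [tateCoeff_sum, tateCoeff_smul, tateCoeff_monomial, mul_ite, mul_one, mul_zero,
      Finset.sum_ite_eq]
    split_ifs with h
    · rfl
    · exact hs l fun h' => h ((hmem l).2 h')
  rw [Ideal.Quotient.eq.2 hr, hsum, map_sum]
  refine Submodule.sum_mem _ fun m _ => ?_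
  exact Submodule.smul_mem _ (tateCoeff (m : Fin n →₀ ℕ) r)
    (Submodule.subset_span (Set.mem_range_self m))

end Division

/-! ### Coordinates of monomials in the quotient -/

section Coordinates

variable {n s : ℕ} {K : Type u} [NontriviallyNormedField K] [IsUltrametricDist K]
  {mo : MonomialOrder.{0, v} (Fin n)} {I : Ideal (TateAlgebra n K)}
  {G : Fin s → TateAlgebra n K} {lm : Fin s → (Fin n →₀ ℕ)} {B : Finset (Fin n →₀ ℕ)}
  {b : Module.Basis B K (TateAlgebra n K ⧸ I)}

theorem sub_sum_repr_mem
    (hb : ∀ m : B, b m = Ideal.Quotient.mk I (tateMonomial K (m : Fin n →₀ ℕ)))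
    (f : TateAlgebra n K) :
    f - ∑ μ : B, b.repr (Ideal.Quotient.mk I f) μ • tateMonomial K (μ : Fin n →₀ ℕ) ∈ I := by
  rw [← Ideal.Quotient.eq]
  conv_lhs => rw [← b.sum_repr (Ideal.Quotient.mk I f)]
  rw [map_sum]
  exact Finset.sum_congr rfl fun μ _ => by rw [hb]; rfl

open Classical in
theorem tateCoeff_sum_monomial (c : B → K) (m : Fin n →₀ ℕ) :
    tateCoeff m (∑ μ : B, c μ • tateMonomial K (μ : Fin n →₀ ℕ))
      = if h : m ∈ B then c ⟨m, h⟩ else 0 := by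
  simp only [tateCoeff_sum, tateCoeff_smul, tateCoeff_monomial, mul_ite, mul_one, mul_zero]
  split_ifs with h
  · rw [Finset.sum_eq_single ⟨m, h⟩ (fun μ _ hμ => if_neg fun h' => hμ (Subtype.ext h'.symm))
      (by simp), if_pos rfl]
  · exact Finset.sum_eq_zero fun μ _ => if_neg fun h' : m = μ => h (h' ▸ μ.2)

/-- The leading monomial of `X^m` minus its normal form is `X^m`. -/
theorem isLeadingMonomial_sub_normalForm (hG : IsGroebnerBasis mo I G)
    (hlm : ∀ a, IsLeadingMonomial mo (G a) (lm a)) (hB : (B : Set (Fin n →₀ ℕ)) = staircase lm)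
    (hb : ∀ m : B, b m = Ideal.Quotient.mk I (tateMonomial K (m : Fin n →₀ ℕ)))
    {m : Fin n →₀ ℕ} (hm : m ∉ B) :
    IsLeadingMonomial mo (tateMonomial K m - ∑ μ : B,
      b.repr (Ideal.Quotient.mk I (tateMonomial K m)) μ • tateMonomial K (μ : Fin n →₀ ℕ)) m := by
  have hI := sub_sum_repr_mem hb (tateMonomial K m)
  generalize hf : tateMonomial K m - ∑ μ : B, b.repr (Ideal.Quotient.mk I (tateMonomial K m)) μ •
    tateMonomial K (μ : Fin n →₀ ℕ) = f at hI ⊢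
  have hfm : tateCoeff m f = 1 := by
    rw [← hf, tateCoeff_sub, tateCoeff_sum_monomial, dif_neg hm, tateCoeff_monomial]
    simp
  obtain ⟨l, hl⟩ := exists_isLeadingMonomial mo (f := f) fun h => by simp [h] at hfm
  have hlB : l ∉ B := by
    rw [← Finset.mem_coe, hB]
    exact hG.not_mem_staircase hlm hI hl
  -- `m` is the only monomial outside `B` with a nonzero coefficient in `f`.
  have : l = m := by
    by_contra hne
    apply hl.1
    rw [← hf, tateCoeff_sub, tateCoeff_sum_monomial, dif_neg hlB, tateCoeff_monomial]
    simp [hne]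
  exact this ▸ hl

theorem norm_repr_le_and_lt (hG : IsGroebnerBasis mo I G)
    (hlm : ∀ a, IsLeadingMonomial mo (G a) (lm a)) (hB : (B : Set (Fin n →₀ ℕ)) = staircase lm)
    (hb : ∀ m : B, b m = Ideal.Quotient.mk I (tateMonomial K (m : Fin n →₀ ℕ)))
    {m : Fin n →₀ ℕ} (hm : m ∉ B) (μ : B) :
    ‖b.repr (Ideal.Quotient.mk I (tateMonomial K m)) μ‖ ≤ 1 ∧
      (1 ≤ ‖b.repr (Ideal.Quotient.mk I (tateMonomial K m)) μ‖ →
        mo.toSyn (μ : Fin n →₀ ℕ) < mo.toSyn m) := by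
  have hl := isLeadingMonomial_sub_normalForm hG hlm hB hb hm
  have hne : (μ : Fin n →₀ ℕ) ≠ m := fun h => hm (h ▸ μ.2)
  have h1 := hl.norm_le μ
  have h2 := hl.lt hne
  simp only [tateCoeff_sub, tateCoeff_sum_monomial, tateCoeff_monomial, dif_neg hm, if_neg hne,
    dif_pos μ.2, if_true, sub_zero, zero_sub, norm_neg, norm_one] at h1 h2
  exact ⟨h1, h2⟩

theorem norm_repr_le_one (hG : IsGroebnerBasis mo I G)
    (hlm : ∀ a, IsLeadingMonomial mo (G a) (lm a)) (hB : (B : Set (Fin n →₀ ℕ)) = staircase lm)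
    (hb : ∀ m : B, b m = Ideal.Quotient.mk I (tateMonomial K (m : Fin n →₀ ℕ)))
    (m : Fin n →₀ ℕ) (μ : B) : ‖b.repr (Ideal.Quotient.mk I (tateMonomial K m)) μ‖ ≤ 1 := by
  classical
  by_cases hm : m ∈ B
  · rw [← hb ⟨m, hm⟩, b.repr_self, Finsupp.single_apply]
    split_ifs <;> simp
  · exact (norm_repr_le_and_lt hG hlm hB hb hm μ).1

/-- Subtracting `G a` from `X^(lm a)` minus its normal form cancels the leading term; reducedness
leaves only staircase monomials, so this element of `I` is zero. -/
theorem repr_leadingMonomial (hG : IsGroebnerBasis mo I G) (hred : IsReduced mo G)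
    (hlm : ∀ a, IsLeadingMonomial mo (G a) (lm a)) (hmon : ∀ a, tateCoeff (lm a) (G a) = 1)
    (hB : (B : Set (Fin n →₀ ℕ)) = staircase lm)
    (hb : ∀ m : B, b m = Ideal.Quotient.mk I (tateMonomial K (m : Fin n →₀ ℕ)))
    (a : Fin s) (μ : B) :
    b.repr (Ideal.Quotient.mk I (tateMonomial K (lm a))) μ = -tateCoeff (μ : Fin n →₀ ℕ) (G a) := by
  have hmem : ∀ m, m ∈ B ↔ m ∈ staircase lm := fun m => by rw [← hB, Finset.mem_coe]
  have hla : lm a ∉ B := fun h => (hmem _).1 h a le_rfl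
  have h0 := hG.eq_zero hlm (I.sub_mem (sub_sum_repr_mem hb (tateMonomial K (lm a))) (hG.1 a))
    fun m hm => by
      rw [tateCoeff_sub, tateCoeff_sub, tateCoeff_sum_monomial,
        dif_neg fun h => hm ((hmem m).1 h), tateCoeff_monomial]
      split_ifs with h
      · rw [h, hmon]; simp
      · rw [hred.tateCoeff_eq_zero hlm a hm h]; simp
  have := congrArg (tateCoeff (μ : Fin n →₀ ℕ)) h0
  rw [tateCoeff_sub, tateCoeff_sub, tateCoeff_sum_monomial, dif_pos μ.2, tateCoeff_monomial,
    if_neg fun h : (μ : Fin n →₀ ℕ) = lm a => hla (h ▸ μ.2), tateCoeff_zero] at this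
  linear_combination -this

/-- Expand `X^m` in the basis and multiply by `X^l`. For `X^l = X_j` this is the exact counterpart
of the product `T_j w` in the algorithm. -/
theorem repr_add
    (hb : ∀ m : B, b m = Ideal.Quotient.mk I (tateMonomial K (m : Fin n →₀ ℕ)))
    (l m : Fin n →₀ ℕ) (μ : B) :
    b.repr (Ideal.Quotient.mk I (tateMonomial K (l + m))) μ
      = ∑ ν : B, b.repr (Ideal.Quotient.mk I (tateMonomial K (l + ν))) μ
          * b.repr (Ideal.Quotient.mk I (tateMonomial K m)) ν := by
  have : Ideal.Quotient.mk I (tateMonomial K (l + m))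
      = ∑ ν : B, b.repr (Ideal.Quotient.mk I (tateMonomial K m)) ν •
          Ideal.Quotient.mk I (tateMonomial K (l + ν)) := by
    rw [← tateMonomial_mul, map_mul]
    conv_lhs => rw [← b.sum_repr (Ideal.Quotient.mk I (tateMonomial K m))]
    rw [Finset.mul_sum]
    refine Finset.sum_congr rfl fun ν _ => ?_
    rw [hb, mul_smul_comm, ← map_mul, tateMonomial_mul]
  rw [← b.coord_apply, this, map_sum (b.coord μ)]
  refine Finset.sum_congr rfl fun ν _ => ?_
  rw [map_smul (b.coord μ), b.coord_apply, smul_eq_mul, mul_comm]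

end Coordinates

/-! ### Values and costs of schoolbook products -/

namespace Counted

variable {R : Type u} [CommRing R]

theorem val_bind {α β : Type u} (x : Counted α) (f : α → Counted β) :
    (x >>= f).val = (f x.val).val := rfl

theorem ops_bind {α β : Type u} (x : Counted α) (f : α → Counted β) :
    (x >>= f).ops = x.ops + (f x.val).ops := rfl

theorem val_pure {α : Type u} (x : α) : (pure x : Counted α).val = x := rfl

theorem ops_pure {α : Type u} (x : α) : (pure x : Counted α).ops = 0 := rfl

theorem val_foldlM_dot {ι : Type} (a b : ι → R) (l : List ι) (c : R) :
    (l.foldlM (fun c i => do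
      let p ← mul (a i) (b i)
      add c p) c).val = c + (l.map fun i => a i * b i).sum := by
  induction l generalizing c with
  | nil => simp [val_pure]
  | cons i l ih =>
    rw [List.foldlM_cons, val_bind, ih, List.map_cons, List.sum_cons, ← add_assoc]
    rfl

theorem ops_foldlM_dot {ι : Type} (a b : ι → R) (l : List ι) (c : R) :
    (l.foldlM (fun c i => do
      let p ← mul (a i) (b i)
      add c p) c).ops = 2 * l.length := by
  induction l generalizing c with
  | nil => simp [ops_pure]
  | cons i l ih =>
    rw [List.foldlM_cons, ops_bind, ih, List.length_cons, mul_add, add_comm]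
    rfl

theorem val_dot {ι : Type} [Fintype ι] (a b : ι → R) : (dot a b).val = ∑ i, a i * b i := by
  rw [dot, val_foldlM_dot, zero_add, Finset.sum_map_toList]

theorem ops_dot {ι : Type} [Fintype ι] (a b : ι → R) : (dot a b).ops = 2 * Fintype.card ι := by
  rw [dot, ops_foldlM_dot, Finset.length_toList, Finset.card_univ]

theorem val_mulVec {ι : Type} [Fintype ι] (M : Matrix ι ι R) (w : ι → R) (i : ι) :
    (mulVec M w).val i = ∑ j, M i j * w j := val_dot _ _

theorem ops_mulVec {ι : Type} [Fintype ι] (M : Matrix ι ι R) (w : ι → R) :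
    (mulVec M w).ops = 2 * Fintype.card ι ^ 2 := by
  change ∑ i, (dot (M i) w).ops = _
  simp only [ops_dot, Finset.sum_const, Finset.card_univ, smul_eq_mul]
  ring

end Counted

/-! ### Reading and replacing columns -/

section Columns

variable {n : ℕ} {B : Finset (Fin n →₀ ℕ)} {R : Type u}

theorem getCol_setCol_self (T : MatFamily B R) (p : Fin n × B) (w : B → R) :
    getCol (setCol T p w) p = w := by
  funext μ
  simp [getCol, setCol]

theorem getCol_setCol_of_ne (T : MatFamily B R) {p q : Fin n × B} (h : q ≠ p) (w : B → R) :
    getCol (setCol T p w) q = getCol T q := by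
  funext μ
  by_cases h1 : q.1 = p.1
  · have h2 : q.2 ≠ p.2 := fun h2 => h (Prod.ext h1 h2)
    simp [getCol, setCol, h1, Matrix.updateCol_ne h2]
  · simp [getCol, setCol, Function.update_of_ne h1]

end Columns

/-! ### Cost of a pass -/

section Cost

variable {n s : ℕ} {mo : MonomialOrder.{0, v} (Fin n)} {B : Finset (Fin n →₀ ℕ)} {R : Type u}
  [CommRing R] (share : Bool) (lm : Fin s → (Fin n →₀ ℕ)) (g : Fin s → MvPolynomial (Fin n) R)

theorem ops_newColumn_le (pick : Fin n × B → Fin n × B) (T : MatFamily B R) (p : Fin n × B) :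
    (newColumn lm g pick T p).ops ≤ 2 * B.card ^ 2 := by
  unfold newColumn
  split_ifs with h
  · have : (Counted.vec fun μ : B => Counted.neg
        (MvPolynomial.coeff (μ : Fin n →₀ ℕ) (g h.choose))).ops = B.card := by
      change ∑ _μ : B, 1 = _
      simp
    rw [this]
    nlinarith [Nat.le_self_pow two_ne_zero B.card]
  · simp [Counted.ops_mulVec]

theorem ops_mulMatStep_of_mem (pick : Fin n × B → Fin n × B) (done : List (Fin n × B))
    (T : MatFamily B R) {p : Fin n × B} (hp : next p ∈ B) :
    (mulMatStep share lm g pick done T p).ops = 0 := by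
  rw [mulMatStep, dif_pos hp, Counted.ops_pure]

theorem ops_mulMatStep_of_find (pick : Fin n × B → Fin n × B) {done : List (Fin n × B)}
    (T : MatFamily B R) {p q : Fin n × B} (hp : next p ∉ B) (hq : q ∈ done)
    (h : next q = next p) : (mulMatStep true lm g pick done T p).ops = 0 := by
  obtain ⟨q', hq'⟩ : ∃ q', done.find? (fun q => decide (next q = next p)) = some q' := by
    rw [← Option.isSome_iff_exists, List.find?_isSome]
    exact ⟨q, hq, by simpa using h⟩
  rw [mulMatStep, dif_neg hp, if_pos rfl, hq']
  rfl

theorem ops_mulMatStep_le (pick : Fin n × B → Fin n × B) (done : List (Fin n × B))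
    (T : MatFamily B R) (p : Fin n × B) :
    (mulMatStep share lm g pick done T p).ops ≤ 2 * B.card ^ 2 := by
  rw [mulMatStep]
  split_ifs with hp
  · simp [Counted.ops_pure]
  all_goals
    split
    · simp [Counted.ops_pure]
    · rw [Counted.ops_bind, Counted.ops_pure, add_zero]
      exact ops_newColumn_le lm g pick T p

/-- The cost of a pass is bounded by the growth of a potential that pays for each step. -/
theorem ops_foldlM_mulMatStep_le (pick : Fin n × B → Fin n × B)
    (φ : List (Fin n × B) → ℕ)
    (hφ : ∀ done T p, (mulMatStep share lm g pick done T p).ops + φ done ≤ φ (done ++ [p]))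
    (l : List (Fin n × B)) (st : List (Fin n × B) × MatFamily B R) :
    (l.foldlM (fun (st : List (Fin n × B) × MatFamily B R) p => do
      let T' ← mulMatStep share lm g pick st.1 st.2 p
      pure (st.1 ++ [p], T')) st).ops + φ st.1 ≤ φ (st.1 ++ l) := by
  induction l generalizing st with
  | nil => simp [Counted.ops_pure]
  | cons p l ih =>
    rw [List.foldlM_cons, Counted.ops_bind]
    have h1 := hφ st.1 st.2 p
    have h2 := ih (st.1 ++ [p], (mulMatStep share lm g pick st.1 st.2 p).val)
    simp only [List.append_assoc, List.singleton_append] at h2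
    simp only [Counted.ops_bind, Counted.val_bind, Counted.ops_pure, Counted.val_pure, add_zero]
    omega

theorem ops_mulMatPass_le (sched : Schedule mo B) (T : MatFamily B R)
    (φ : List (Fin n × B) → ℕ)
    (hφ : ∀ done T p,
      (mulMatStep share lm g sched.pick done T p).ops + φ done ≤ φ (done ++ [p])) :
    (mulMatPass share lm g sched T).ops ≤ φ sched.pairs := by
  have := ops_foldlM_mulMatStep_le share lm g sched.pick φ hφ sched.pairs ([], T)
  rw [mulMatPass, Counted.ops_bind, Counted.ops_pure]
  exact (Nat.le_add_right _ _).trans this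

theorem next_mem_boundary {p : Fin n × B} (hp : next p ∉ B) : next p ∈ boundary B :=
  Finset.mem_sdiff.2 ⟨Finset.mem_image_of_mem _ (Finset.mem_univ p), hp⟩

/-- The potential is `2δ²` times the number of boundary monomials already met: a step either is free
or meets a new one. -/
theorem ops_mulMatPass_true_le (sched : Schedule mo B) (T : MatFamily B R) :
    (mulMatPass true lm g sched T).ops ≤ 2 * (B.card ^ 2 * (boundary B).card) := by
  classical
  let S : List (Fin n × B) → Finset (Fin n →₀ ℕ) := fun l =>
    (l.toFinset.image next).filter (· ∉ B)
  have hS : ∀ l m, m ∈ S l ↔ (∃ q ∈ l, next q = m) ∧ m ∉ B := fun l m => by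
    simp only [S, Finset.mem_filter, Finset.mem_image, List.mem_toFinset]
  refine (ops_mulMatPass_le true lm g sched T (fun l => 2 * B.card ^ 2 * (S l).card)
    fun done T p => ?_).trans ?_
  · have hmono : S done ⊆ S (done ++ [p]) := fun m hm => by
      obtain ⟨⟨q, hq, h⟩, hm⟩ := (hS _ _).1 hm
      exact (hS _ _).2 ⟨⟨q, List.mem_append_left _ hq, h⟩, hm⟩
    by_cases hfree : next p ∈ B ∨ ∃ q ∈ done, next q = next p
    · have h0 : (mulMatStep true lm g sched.pick done T p).ops = 0 := by
        by_cases hp : next p ∈ B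
        · exact ops_mulMatStep_of_mem true lm g sched.pick done T hp
        · obtain ⟨q, hq, h⟩ := hfree.resolve_left hp
          exact ops_mulMatStep_of_find lm g sched.pick T hp hq h
      rw [h0, zero_add]
      exact Nat.mul_le_mul_left _ (Finset.card_le_card hmono)
    · rw [not_or] at hfree
      have hlt : (S done).card + 1 ≤ (S (done ++ [p])).card := by
        refine Finset.card_lt_card ((Finset.ssubset_iff_of_subset hmono).2 ⟨next p, ?_, ?_⟩)
        · exact (hS _ _).2 ⟨⟨p, by simp, rfl⟩, hfree.1⟩
        · exact fun h => hfree.2 ((hS _ _).1 h).1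
      have := ops_mulMatStep_le true lm g sched.pick done T p
      have := Nat.mul_le_mul_left (2 * B.card ^ 2) hlt
      linarith
  · rw [mul_assoc]
    refine Nat.mul_le_mul_left _ (Nat.mul_le_mul_left _ (Finset.card_le_card fun m hm => ?_))
    obtain ⟨⟨q, -, rfl⟩, hm⟩ := (hS _ _).1 hm
    exact next_mem_boundary hm

/-- Only pairs with `X_i m ∉ B` cost anything, and `(i, m) ↦ (i, X_i m)` injects them into `Fin n ×
boundary B`. -/
theorem ops_mulMatPass_false_le (sched : Schedule mo B) (T : MatFamily B R) :
    (mulMatPass false lm g sched T).ops ≤ 2 * (n * (B.card ^ 2 * (boundary B).card)) := by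
  classical
  refine (ops_mulMatPass_le false lm g sched T
    (fun l => 2 * B.card ^ 2 * (l.filter fun p => next p ∉ B).length) fun done T p => ?_).trans ?_
  · by_cases hp : next p ∈ B
    · rw [ops_mulMatStep_of_mem false lm g sched.pick done T hp]
      simp [List.filter_append, hp]
    · have := ops_mulMatStep_le false lm g sched.pick done T p
      simp only [List.filter_append, List.length_append]
      have h1 : (List.filter (fun p : Fin n × B => decide (next p ∉ B)) [p]).length = 1 := by
        simp [hp]
      rw [h1]
      linarith
  · have hcard : (sched.pairs.filter fun p => next p ∉ B).length ≤ n * (boundary B).card := by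
      rw [← List.toFinset_card_of_nodup (sched.nodup.filter _)]
      have : ((Finset.univ : Finset (Fin n)) ×ˢ boundary B).card = n * (boundary B).card := by
        simp
      rw [← this]
      refine Finset.card_le_card_of_injOn (fun p => (p.1, next p)) (fun p hp => ?_)
        fun p _ q _ h => ?_
      · have hp : next p ∉ B := by simpa using (List.mem_filter.1 (List.mem_toFinset.1 hp)).2
        simpa using next_mem_boundary hp
      · obtain ⟨h1, h2⟩ := Prod.mk.inj h
        refine Prod.ext h1 (Subtype.ext ?_)
        rw [next, next, h1] at h2
        exact add_left_cancel h2
    calc _ ≤ 2 * B.card ^ 2 * (n * (boundary B).card) := Nat.mul_le_mul_left _ hcard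
      _ = _ := by ring

end Cost

/-! ### Gain of precision in a pass -/

section Correctness

variable {n s : ℕ} {K : Type u} [NontriviallyNormedField K] [IsUltrametricDist K]
  {mo : MonomialOrder.{0, v} (Fin n)} {lm : Fin s → (Fin n →₀ ℕ)} {B : Finset (Fin n →₀ ℕ)}
  {c : (Fin n →₀ ℕ) → B → K} {g : Fin s → MvPolynomial (Fin n) 𝒪[K]} {ϖ : K} {prec : ℕ}

/-- A monomial `X_i m ∉ B` that is not the leading monomial of a generator has a factorization. -/
theorem exists_isFactorization (hB : (B : Set (Fin n →₀ ℕ)) = staircase lm) {p : Fin n × B}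
    (hp : next p ∉ B) (hne : ¬ ∃ a, lm a = next p) : ∃ q, IsFactorization p q := by
  have hmem : ∀ m, m ∈ B ↔ ∀ a, ¬ lm a ≤ m := fun m => by rw [← Finset.mem_coe, hB]; rfl
  obtain ⟨i, m, hm⟩ := p
  simp only [hmem, not_forall, not_not] at hp
  obtain ⟨a, ha⟩ := hp
  -- `lm a` divides `X_i m` properly, so some exponent has room and `X_j * X^(lm a)` still divides
  -- `X_i m`.
  obtain ⟨j, hj⟩ : ∃ j, lm a j < next (i, (⟨m, hm⟩ : B)) j := by
    by_contra! h
    exact hne ⟨a, le_antisymm ha h⟩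
  have hlt : Finsupp.single j 1 + lm a ≤ Finsupp.single i 1 + m := fun k => by
    have h1 := ha k
    simp only [next] at h1 hj
    by_cases hk : k = j
    · subst hk
      rw [Finsupp.add_apply, Finsupp.single_eq_same]
      omega
    · simpa [Finsupp.single_eq_of_ne hk] using h1
  -- If `i = j`, cancelling `X_i` would make `X^(lm a)` divide `m ∈ B`. Hence the spare factor `X_j`
  -- comes from `m`.
  have hij : i ≠ j := by
    rintro rfl
    exact (hmem m).1 hm a (le_of_add_le_add_left hlt)
  have hmj : Finsupp.single j 1 ≤ m := by
    rw [Finsupp.single_le_iff]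
    have := hlt j
    rw [Finsupp.add_apply, Finsupp.add_apply, Finsupp.single_eq_same,
      Finsupp.single_eq_of_ne hij.symm] at this
    omega
  obtain ⟨m', rfl⟩ := exists_add_of_le hmj
  have hm' : m' ∈ B := (hmem _).2 fun b hb => (hmem _).1 hm b (hb.trans le_add_self)
  refine ⟨(j, ⟨m', hm'⟩), rfl, fun h => (hmem _).1 h a ?_⟩
  rw [add_left_comm] at hlt
  exact le_of_add_le_add_left hlt

/-- The column of the pair `p` is congruent to the coordinate vector of `X_i m`. -/
def ColClose (c : (Fin n →₀ ℕ) → B → K) (ϖ : K) (k : ℕ) (w : B → 𝒪[K]) (m : Fin n →₀ ℕ) : Prop :=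
  ∀ μ, ‖(w μ : K) - c m μ‖ ≤ ‖ϖ‖ ^ k

theorem ColClose.mono (h1 : ‖ϖ‖ ≤ 1) {k l : ℕ} (hkl : k ≤ l) {w : B → 𝒪[K]} {m : Fin n →₀ ℕ}
    (h : ColClose c ϖ l w m) : ColClose c ϖ k w m :=
  fun μ => (h μ).trans (pow_le_pow_of_le_one (norm_nonneg _) h1 hkl)

/-- The properties of the coordinate vectors `c m` of the monomials in the quotient that
make the algorithm work. -/
structure IsNormalForm (mo : MonomialOrder.{0, v} (Fin n)) (lm : Fin s → (Fin n →₀ ℕ))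
    (B : Finset (Fin n →₀ ℕ)) (c : (Fin n →₀ ℕ) → B → K) : Prop where
  coe_eq : (B : Set (Fin n →₀ ℕ)) = staircase lm
  norm_le_one : ∀ m μ, ‖c m μ‖ ≤ 1
  lt_of_one_le : ∀ m ∉ B, ∀ μ, 1 ≤ ‖c m μ‖ → mo.toSyn (μ : Fin n →₀ ℕ) < mo.toSyn m
  of_mem : ∀ m (h : m ∈ B), c m = Pi.single ⟨m, h⟩ 1
  add : ∀ l m μ, c (l + m) μ = ∑ ν : B, c (l + (ν : Fin n →₀ ℕ)) μ * c m ν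

/-- The product `T_j w` gains one digit of precision. -/
theorem IsNormalForm.colClose_mulVec (hc : IsNormalForm mo lm B c) (h1 : ‖ϖ‖ < 1)
    (hϖ : ∀ x : K, ‖x‖ < 1 → ‖x‖ ≤ ‖ϖ‖) {k l : ℕ} (hl : l ≤ k + 1) {j : Fin n}
    {m : Fin n →₀ ℕ} (hm : m ∉ B) {T : MatFamily B 𝒪[K]} {w : B → 𝒪[K]}
    (hw : ColClose c ϖ l w m) (hT : ∀ ν : B, ColClose c ϖ k (getCol T (j, ν)) (next (j, ν)))
    (hT' : ∀ ν : B, mo.toSyn (ν : Fin n →₀ ℕ) < mo.toSyn m →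
      ColClose c ϖ l (getCol T (j, ν)) (next (j, ν))) :
    ColClose c ϖ l (Counted.mulVec (T j) w).val (Finsupp.single j 1 + m) := fun μ => by
  rw [Counted.val_mulVec, hc.add]
  push_cast
  rw [← Finset.sum_sub_distrib]
  refine IsUltrametricDist.norm_sum_le_of_forall_le_of_nonneg (by positivity) fun ν _ => ?_
  have hsplit : (T j μ ν : K) * (w ν : K) - c (Finsupp.single j 1 + (ν : Fin n →₀ ℕ)) μ * c m ν
      = (T j μ ν : K) * ((w ν : K) - c m ν)
        + ((T j μ ν : K) - c (Finsupp.single j 1 + (ν : Fin n →₀ ℕ)) μ) * c m ν := by ring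
  rw [hsplit]
  refine (IsUltrametricDist.norm_add_le_max _ _).trans (max_le ?_ ?_)
  · rw [norm_mul]
    exact (mul_le_of_le_one_left (norm_nonneg _) (Valued.integer.norm_le_one (T j μ ν))).trans
      (hw ν)
  · rw [norm_mul]
    -- A unit coordinate sits at `ν < m`, where the column has precision `l`; this needs `m ∉ B`,
    -- hence the condition on factorizations. Otherwise the coordinate supplies a factor `ϖ`.
    by_cases hν : 1 ≤ ‖c m ν‖
    · exact (mul_le_of_le_one_right (norm_nonneg _) (hc.norm_le_one m ν)).trans
        (hT' ν (hc.lt_of_one_le m hm ν hν) μ)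
    · calc _ ≤ ‖ϖ‖ ^ k * ‖ϖ‖ :=
          mul_le_mul (hT ν μ) (hϖ _ (not_le.1 hν)) (norm_nonneg _) (by positivity)
        _ = ‖ϖ‖ ^ (k + 1) := (pow_succ _ _).symm
        _ ≤ ‖ϖ‖ ^ l := pow_le_pow_of_le_one (norm_nonneg _) h1.le hl

/-- With `m = X_j m'`, the vector used is the column of `X_i m' < X_i m`, and `ν < X_i m'` gives
`X_j ν < X_i m`. So the new precision is only needed at strictly smaller products, and the order
among ties is irrelevant. -/
theorem IsNormalForm.colClose_newColumn (hc : IsNormalForm mo lm B c) (h1 : ‖ϖ‖ < 1)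
    (hϖ : ∀ x : K, ‖x‖ < 1 → ‖x‖ ≤ ‖ϖ‖)
    (hg : ∀ a (μ : B), ‖(-MvPolynomial.coeff (μ : Fin n →₀ ℕ) (g a) : K) - c (lm a) μ‖
      ≤ ‖ϖ‖ ^ prec) {k l : ℕ} (hl : l ≤ k + 1) (hlp : l ≤ prec) (sched : Schedule mo B)
    {T : MatFamily B 𝒪[K]} {p : Fin n × B} (hp : next p ∉ B)
    (hT : ∀ q, ColClose c ϖ k (getCol T q) (next q))
    (hT' : ∀ q, mo.toSyn (next q) < mo.toSyn (next p) → ColClose c ϖ l (getCol T q) (next q)) :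
    ColClose c ϖ l (newColumn lm g sched.pick T p).val (next p) := by
  unfold newColumn
  split_ifs with h
  · intro μ
    have := hg h.choose μ
    rw [h.choose_spec] at this
    exact this.trans (pow_le_pow_of_le_one (norm_nonneg _) h1.le hlp)
  · obtain ⟨hq1, hq2⟩ := sched.pick_spec p (exists_isFactorization hc.coe_eq hp h)
    have hnext : next p = Finsupp.single (sched.pick p).1 1 + next (p.1, (sched.pick p).2) := by
      rw [next, hq1, next, next, add_left_comm]
    have hpos : 0 < mo.toSyn (Finsupp.single (sched.pick p).1 1) := by
      refine lt_of_le_of_ne (mo.zero_le _) fun h0 => ?_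
      have := (map_eq_zero_iff mo.toSyn mo.toSyn.injective).1 h0.symm
      simp at this
    rw [hnext] at hT' ⊢
    refine hc.colClose_mulVec h1 hϖ hl hq2 (hT' _ ?_) (fun ν => hT _) fun ν hν => hT' _ ?_
    · rw [map_add]
      exact lt_add_of_pos_left _ hpos
    · rw [map_add, next, map_add]
      exact add_lt_add_right hν _

theorem IsNormalForm.colClose_mulMatStep (hc : IsNormalForm mo lm B c) (h1 : ‖ϖ‖ < 1)
    (hϖ : ∀ x : K, ‖x‖ < 1 → ‖x‖ ≤ ‖ϖ‖)
    (hg : ∀ a (μ : B), ‖(-MvPolynomial.coeff (μ : Fin n →₀ ℕ) (g a) : K) - c (lm a) μ‖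
      ≤ ‖ϖ‖ ^ prec) {k l : ℕ} (hl : l ≤ k + 1) (hlp : l ≤ prec) (share : Bool)
    (sched : Schedule mo B) {done : List (Fin n × B)}
    {T : MatFamily B 𝒪[K]} {p : Fin n × B}
    (hT : ∀ q, ColClose c ϖ k (getCol T q) (next q))
    (hdone : ∀ q ∈ done, ColClose c ϖ l (getCol T q) (next q))
    (hlt : ∀ q, mo.toSyn (next q) < mo.toSyn (next p) → q ∈ done) :
    ∃ w, (mulMatStep share lm g sched.pick done T p).val = setCol T p w ∧
      ColClose c ϖ l w (next p) := by
  by_cases hp : next p ∈ B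
  · refine ⟨Pi.single ⟨next p, hp⟩ 1, by rw [mulMatStep, dif_pos hp]; rfl, fun μ => ?_⟩
    rw [hc.of_mem _ hp]
    have : (((Pi.single ⟨next p, hp⟩ 1 : B → 𝒪[K]) μ : 𝒪[K]) : K)
        = (Pi.single ⟨next p, hp⟩ 1 : B → K) μ := by
      rw [Pi.single_apply, Pi.single_apply]
      split_ifs <;> rfl
    rw [this, sub_self, norm_zero]
    positivity
  · rw [mulMatStep, dif_neg hp]
    split
    · rename_i q hq
      refine ⟨getCol T q, rfl, ?_⟩
      cases share
      · simp at hq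
      · rw [if_pos rfl] at hq
        have h2 : next q = next p := by simpa using List.find?_some hq
        exact h2 ▸ hdone q (List.mem_of_find?_eq_some hq)
    · exact ⟨_, rfl, hc.colClose_newColumn h1 hϖ hg hl hlp sched hp hT
        fun q hq => hdone q (hlt q hq)⟩

/-- Loop invariant: all columns have precision `k`, and those already treated have precision `l`.
The case `l = k` covers passes made once the input precision is reached. -/
theorem IsNormalForm.colClose_mulMatPass (hc : IsNormalForm mo lm B c) (h1 : ‖ϖ‖ < 1)
    (hϖ : ∀ x : K, ‖x‖ < 1 → ‖x‖ ≤ ‖ϖ‖)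
    (hg : ∀ a (μ : B), ‖(-MvPolynomial.coeff (μ : Fin n →₀ ℕ) (g a) : K) - c (lm a) μ‖
      ≤ ‖ϖ‖ ^ prec) {k l : ℕ} (hkl : k ≤ l) (hl : l ≤ k + 1) (hlp : l ≤ prec) (share : Bool)
    (sched : Schedule mo B) {T : MatFamily B 𝒪[K]}
    (hT : ∀ q, ColClose c ϖ k (getCol T q) (next q)) (q : Fin n × B) :
    ColClose c ϖ l (getCol (mulMatPass share lm g sched T).val q) (next q) := by
  suffices H : ∀ (suf : List (Fin n × B)) (st : List (Fin n × B) × MatFamily B 𝒪[K]),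
      sched.pairs = st.1 ++ suf → (∀ q, ColClose c ϖ k (getCol st.2 q) (next q)) →
      (∀ q ∈ st.1, ColClose c ϖ l (getCol st.2 q) (next q)) → ∀ q,
      ColClose c ϖ l (getCol (suf.foldlM
        (fun (st : List (Fin n × B) × MatFamily B 𝒪[K]) p => do
          let T' ← mulMatStep share lm g sched.pick st.1 st.2 p
          pure (st.1 ++ [p], T')) st).val.2 q) (next q) from
    H sched.pairs ([], T) rfl hT (by simp) q
  intro suf
  induction suf with
  | nil =>
    intro st hst _ hd q
    rw [List.append_nil] at hst
    exact hd q (hst ▸ sched.complete q)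
  | cons p suf ih =>
    intro st hst hk hd q
    -- As the pairs are sorted, one with a strictly smaller product cannot come at or after `p`.
    have hlt : ∀ q, mo.toSyn (next q) < mo.toSyn (next p) → q ∈ st.1 := fun q hq => by
      have hmem := sched.complete q
      have hinc := sched.increasing
      rw [hst] at hmem hinc
      rcases List.mem_append.1 hmem with h | h
      · exact h
      rcases List.mem_cons.1 h with rfl | h
      · exact absurd hq (lt_irrefl _)
      · exact absurd hq (not_lt.2 (List.rel_of_pairwise_cons (List.pairwise_append.1 hinc).2.1 h))
    obtain ⟨w, hw, hwc⟩ :=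
      hc.colClose_mulMatStep h1 hϖ hg hl hlp share sched hk hd hlt
    rw [List.foldlM_cons, Counted.val_bind]
    refine ih _ (by simpa [Counted.val_bind, Counted.val_pure] using hst) (fun q => ?_)
      (fun q hq => ?_) q
    · simp only [Counted.val_bind, Counted.val_pure, hw]
      by_cases h : q = p
      · rw [h, getCol_setCol_self]
        exact hwc.mono h1.le hkl
      · rw [getCol_setCol_of_ne st.2 h]
        exact hk q
    · simp only [Counted.val_bind, Counted.val_pure, hw, List.mem_append, List.mem_singleton]
        at hq ⊢
      by_cases h : q = p
      · rw [h, getCol_setCol_self]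
        exact hwc
      · rw [getCol_setCol_of_ne st.2 h]
        exact hd q (hq.resolve_right h)

theorem IsNormalForm.colClose_mulMatRun (hc : IsNormalForm mo lm B c) (h1 : ‖ϖ‖ < 1)
    (hϖ : ∀ x : K, ‖x‖ < 1 → ‖x‖ ≤ ‖ϖ‖)
    (hg : ∀ a (μ : B), ‖(-MvPolynomial.coeff (μ : Fin n →₀ ℕ) (g a) : K) - c (lm a) μ‖
      ≤ ‖ϖ‖ ^ prec) (share : Bool) (sched : ℕ → Schedule mo B) (k : ℕ) (q : Fin n × B) :
    ColClose c ϖ (min k prec) (getCol (mulMatRun share lm g sched k).val q) (next q) := by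
  induction k generalizing q with
  -- The zero matrices are correct modulo `π ^ 0` because the exact entries are integral.
  | zero =>
    intro μ
    have : getCol (mulMatRun share lm g sched 0).val q μ = 0 := rfl
    rw [this]
    simpa using hc.norm_le_one (next q) μ
  | succ k ih =>
    exact hc.colClose_mulMatPass h1 hϖ hg (by omega) (by omega) (by omega) share (sched k) ih q

end Correctness

/-! ### Norms and congruences modulo powers of the uniformizer -/

section Uniformizer

variable {K : Type u} [NontriviallyNormedField K] [IsUltrametricDist K]
  {π : 𝒪[K]}

/-- Discreteness enters here: the maximal ideal, generated by `π`, is the closed ball of radius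
`‖π‖`. -/
theorem norm_le_norm_uniformizer [IsDiscreteValuationRing 𝒪[K]] (hπ : Irreducible π) {x : K}
    (hx : ‖x‖ < 1) : ‖x‖ ≤ ‖(π : K)‖ := by
  let y : 𝒪[K] := ⟨x, Valued.integer.mem_iff.2 hx.le⟩
  have hy : y ∈ (IsLocalRing.maximalIdeal 𝒪[K] : Set 𝒪[K]) := by
    rw [SetLike.mem_coe, IsLocalRing.mem_maximalIdeal, mem_nonunits_iff,
      Valued.integer.isUnit_iff_norm_eq_one]
    exact hx.ne
  rw [hπ.maximalIdeal_eq_closedBall, mem_closedBall_zero_iff] at hy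
  exact hy

theorem congrMod_iff_norm_le (hπ : Irreducible π) (k : ℕ) (x y : K) :
    CongrMod π k x y ↔ ‖x - y‖ ≤ ‖(π : K)‖ ^ k := by
  have hpos : 0 < ‖(π : K)‖ ^ k := pow_pos (Valued.integer.norm_irreducible_pos hπ) k
  constructor
  · rintro ⟨c, hc⟩
    rw [hc, norm_mul, norm_pow]
    exact mul_le_of_le_one_right hpos.le (Valued.integer.norm_le_one c)
  · intro h
    have hne : (π : K) ^ k ≠ 0 := by
      rw [← norm_pos_iff, norm_pow]
      exact hpos
    refine ⟨⟨((π : K) ^ k)⁻¹ * (x - y), Valued.integer.mem_iff.2 ?_⟩,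
      (mul_inv_cancel_left₀ hne _).symm⟩
    rw [norm_mul, norm_inv, norm_pow]
    exact (inv_mul_le_one₀ hpos).2 h

end Uniformizer

theorem isNormalForm_repr {n s : ℕ} {K : Type u} [NontriviallyNormedField K] [IsUltrametricDist K]
    {mo : MonomialOrder.{0, v} (Fin n)} {I : Ideal (TateAlgebra n K)}
    {G : Fin s → TateAlgebra n K} {lm : Fin s → (Fin n →₀ ℕ)} {B : Finset (Fin n →₀ ℕ)}
    {b : Module.Basis B K (TateAlgebra n K ⧸ I)} (hG : IsGroebnerBasis mo I G)
    (hlm : ∀ a, IsLeadingMonomial mo (G a) (lm a)) (hB : (B : Set (Fin n →₀ ℕ)) = staircase lm)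
    (hb : ∀ m : B, b m = Ideal.Quotient.mk I (tateMonomial K (m : Fin n →₀ ℕ))) :
    IsNormalForm mo lm B fun m μ => b.repr (Ideal.Quotient.mk I (tateMonomial K m)) μ where
  coe_eq := hB
  norm_le_one := norm_repr_le_one hG hlm hB hb
  lt_of_one_le _ hm μ := (norm_repr_le_and_lt hG hlm hB hb hm μ).2
  of_mem m hm := by
    funext μ
    rw [← hb ⟨m, hm⟩, b.repr_self, Finsupp.single_apply, Pi.single_apply]
    simp only [eq_comm]
  add := repr_add hb

theorem finite_staircase {n s : ℕ} {K : Type u} [NontriviallyNormedField K] [IsUltrametricDist K]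
    {mo : MonomialOrder.{0, v} (Fin n)} {I : Ideal (TateAlgebra n K)}
    (hfin : Module.Finite K (TateAlgebra n K ⧸ I))
    {G : Fin s → TateAlgebra n K} {lm : Fin s → (Fin n →₀ ℕ)} (hG : IsGroebnerBasis mo I G)
    (hlm : ∀ a, IsLeadingMonomial mo (G a) (lm a)) : (staircase lm).Finite :=
  Set.finite_coe_iff.1 (linearIndependent_staircase (K := K) hG hlm).finite

end TateFGLM

/-! ### Assembly of the theorem -/

theorem mainTheorem3 :
    ∃ C : ℕ, ∀ (K : Type u) [NontriviallyNormedField K] [IsUltrametricDist K] [CompleteSpace K]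
      [IsDiscreteValuationRing 𝒪[K]] (π : 𝒪[K]) (_ : Irreducible π)
      (n s : ℕ) (mo : MonomialOrder.{0, v} (Fin n))
      (I : Ideal (TateFGLM.TateAlgebra n K))
      (_ : Module.Finite K (TateFGLM.TateAlgebra n K ⧸ I))
      (G : Fin s → TateFGLM.TateAlgebra n K)
      (_ : TateFGLM.IsGroebnerBasis mo I G)
      (_ : TateFGLM.IsReduced mo G)
      (lm : Fin s → (Fin n →₀ ℕ))
      (_ : ∀ a, TateFGLM.IsLeadingMonomial mo (G a) (lm a))
      (_ : ∀ a, TateFGLM.tateCoeff (lm a) (G a) = 1)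
      (prec : ℕ)
      (g : Fin s → MvPolynomial (Fin n) 𝒪[K])
      (_ : ∀ a m, TateFGLM.CongrMod π prec ((MvPolynomial.coeff m (g a) : 𝒪[K]) : K)
        (TateFGLM.tateCoeff m (G a))),
      ∃ B : Finset (Fin n →₀ ℕ), (B : Set (Fin n →₀ ℕ)) = TateFGLM.staircase lm ∧
        ∃ b : Module.Basis B K (TateFGLM.TateAlgebra n K ⧸ I),
          (∀ m : B, b m = Ideal.Quotient.mk I (TateFGLM.tateMonomial K (m : Fin n →₀ ℕ))) ∧
          ∀ sched : ℕ → TateFGLM.Schedule mo B,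
            (∀ share : Bool,
              (∀ k ≤ prec, ∀ (i : Fin n) (μ m : B), TateFGLM.CongrMod π k
                (((TateFGLM.mulMatRun share lm g sched k).val i μ m : 𝒪[K]) : K)
                (LinearMap.toMatrix b b (LinearMap.mulLeft K (Ideal.Quotient.mk I
                  (TateFGLM.tateMonomial K (Finsupp.single i 1)))) μ m)) ∧
              (∀ (i : Fin n) (μ m : B), TateFGLM.CongrMod π prec
                (((TateFGLM.mulMatIter share lm g sched prec).val i μ m : 𝒪[K]) : K)
                (LinearMap.toMatrix b b (LinearMap.mulLeft K (Ideal.Quotient.mk I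
                  (TateFGLM.tateMonomial K (Finsupp.single i 1)))) μ m))) ∧
            (∀ k : ℕ,
              TateFGLM.passCost true lm g sched k
                ≤ C * (B.card ^ 2 * (TateFGLM.boundary B).card) ∧
              TateFGLM.passCost false lm g sched k
                ≤ C * (n * (B.card ^ 2 * (TateFGLM.boundary B).card))) := by
  -- One multiplication and one addition per matrix entry.
  refine ⟨2, ?_⟩
  intro K _ _ _ _ π hπ n s mo I hfin G hG hred lm hlm hmon prec g hg
  have h0 : (π : K) ≠ 0 := norm_pos_iff.1 (Valued.integer.norm_irreducible_pos hπ)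
  have h1 : ‖(π : K)‖ < 1 := Valued.integer.norm_irreducible_lt_one hπ
  have hϖ : ∀ x : K, ‖x‖ < 1 → ‖x‖ ≤ ‖(π : K)‖ :=
    fun x hx => TateFGLM.norm_le_norm_uniformizer hπ hx
  have hB : (((TateFGLM.finite_staircase hfin hG hlm).toFinset : Finset (Fin n →₀ ℕ)) :
      Set (Fin n →₀ ℕ)) = TateFGLM.staircase lm := Set.Finite.coe_toFinset _
  generalize (TateFGLM.finite_staircase hfin hG hlm).toFinset = B at hB
  obtain ⟨b, hb⟩ := TateFGLM.exists_basis h0 h1 hϖ hG hlm hmon hB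
  refine ⟨B, hB, b, hb, fun sched => ⟨fun share => ?_, fun k =>
    ⟨TateFGLM.ops_mulMatPass_true_le lm g (sched k) _,
      TateFGLM.ops_mulMatPass_false_le lm g (sched k) _⟩⟩⟩
  have hg' : ∀ a (μ : B), ‖(-MvPolynomial.coeff (μ : Fin n →₀ ℕ) (g a) : K)
      - b.repr (Ideal.Quotient.mk I (TateFGLM.tateMonomial K (lm a))) μ‖
        ≤ ‖(π : K)‖ ^ prec := fun a μ => by
    rw [TateFGLM.repr_leadingMonomial hG hred hlm hmon hB hb, ← neg_sub', norm_neg]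
    exact (TateFGLM.congrMod_iff_norm_le hπ _ _ _).1 (hg a μ)
  have key : ∀ (k : ℕ) (i : Fin n) (μ m : B), TateFGLM.CongrMod π (min k prec)
      (((TateFGLM.mulMatRun share lm g sched k).val i μ m : 𝒪[K]) : K)
      (LinearMap.toMatrix b b (LinearMap.mulLeft K (Ideal.Quotient.mk I
        (TateFGLM.tateMonomial K (Finsupp.single i 1)))) μ m) := fun k i μ m => by
    rw [TateFGLM.congrMod_iff_norm_le hπ, LinearMap.toMatrix_apply, LinearMap.mulLeft_apply, hb,
      ← map_mul, TateFGLM.tateMonomial_mul]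
    exact (TateFGLM.isNormalForm_repr hG hlm hB hb).colClose_mulMatRun h1 hϖ hg' share sched k
      (i, m) μ
  refine ⟨fun k hk i μ m => ?_, fun i μ m => ?_⟩
  · simpa only [min_eq_left hk] using key k i μ m
  -- The run has `prec + 1` passes; the last one preserves the precision `prec` already reached.
  · have := key (prec + 1) i μ m
    rw [min_eq_right (Nat.le_succ prec)] at this
    exact this
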